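/- **Setting.** Let $S$ be a scheme, $G$ a smooth group scheme over $S$ with unit section $e$, $\omega_{G/S}$ the conormal sheaf of $e$ (locally $I/I^2$, with $I$ the ideal of functions vanishing on $e$), and $\mathrm{Lie}(G)$ its $\mathcal O_S$-dual. Let $p:X\to S$ be an arbitrary $S$-scheme. *Infinitesimal simplices.* $\Delta^n_{X/S}$ is the $S$-scheme whose $T$-points are the $(n+1)$-tuples $(x_0,\dots,x_n)$ of $T$-points of $X$ over $S$ that agree topologically and satisfy, for all local functions $b,b'$ on $X$ and all $i,j$, $$(x_i^*b-x_j^*b)(x_i^*b'-x_j^*b')=0,\qquad (x_i^*b-x_0^*b)(x_j^*b-x_0^*b)=0 .$$ A *$G$-valued combinatorial $n$-form* on $X$ is an $S$-morphism $f:\Delta^n_{X/S}\to G$ with $f(x_0,\dots,x_n)=1$ whenever $x_i=x_{i+1}$ for some $i$. For an $S$-morphism $g:X\to G$ and a combinatorial 1-form $\omega$ put $$\delta^0(g)(x_0,x_1)=g(x_0)^{-1}g(x_1),\qquad \delta^1\omega(x_0,x_1,x_2)=\omega(x_0,x_1)\,\omega(x_1,x_2)\,\omega(x_2,x_0).$$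 *Classical forms.* A $\mathrm{Lie}(G)$-valued $n$-form on $X$ is an $\mathcal O_S$-linear map $\varphi:\omega_{G/S}\to p_*\Omega^n_{X/S}$. A morphism $f:\Delta^n_{X/S}\to G$ is said to *correspond to* $\varphi$ if $z\circ f=\varphi(z)$ for every local function $z$ on $G$ vanishing on $e$, where a differential form is regarded as a function on $\Delta^n_{X/S}$ by $$(c\,db_1\wedge\dots\wedge db_n)(x_0,\dots,x_n)=x_0^*c\,\prod_{i=1}^n(x_i^*b_i-x_0^*b_i).$$ For $\varphi$ of degree 1, $d\varphi$ is the composite of $\varphi$ with the exterior derivative (so $d(Y\otimes\eta)=Y\otimes d\eta$), and $[\varphi]^{(2)}(z)=\sum_i\varphi(\alpha_i)\wedge\varphi(\beta_i)$ whenever the comultiplication of $G$ is $z\mapsto z\otimes1+1\otimes z+\sum_i\alpha_i\otimes\beta_i$ with $\alpha_i,\beta_i\in I$, modulo functions vanishing on the product of two copies of the first infinitesimal neighbourhood of $e$. **Theorem 3.3.** (a) For affine opens $V\subseteq S$ and $U\subseteq X$ over $V$, the canonical map $\mathrm{Lie}(G)(V)\otimes_{\mathcal O(V)}\Omega^n_{X/S}(U)\to\mathrm{Hom}_{\mathcal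 O(V)}(\omega_{G/S}(V),\Omega^n_{X/S}(U))$ is bijective for all $n$, where $V$ is small enough that $e(V)$ lies in an affine open of $G$ over $V$. The correspondence above is a bijection between $G$-valued combinatorial 1-forms and $\mathrm{Lie}(G)$-valued 1-forms on $X$. (b) Let $\omega$ be a $\mathrm{Lie}(G)$-valued 1-form on $X$, regarded also as a combinatorial 1-form. Then $\delta^1\omega$ is a combinatorial 2-form, and $$\delta^1\omega=d\omega+[\omega]^{(2)},$$ that is, $\delta^1\omega$ corresponds to the $\mathrm{Lie}(G)$-valued 2-form $d\omega+[\omega]^{(2)}$ and to no other; this is Cartan's structural equation. (c) For every $S$-morphism $g:X\to G$, $\delta^0(g)$ is a combinatorial 1-form and $\delta^1\delta^0(g)=1$. In particular the Maurer–Cartan form $\omega=\delta^0(\mathrm{id}_G)$ on $X=G$ satisfies the Maurer–Cartan equation $d\omega+[\omega]^{(2)}=0$. -/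

import Mathlib

open scoped TensorProduct KaehlerDifferential

universe u

noncomputable section

namespace CombForms

section Algebra

variable (R B : Type u) [CommRing R] [CommRing B] [Algebra R B]

/-- The module of relative differential `n`-forms `Ω^n_{B/R}`, the `n`-th exterior power over `B` of
the module of Kähler differentials. -/
abbrev KForm (n : ℕ) : Type u := ⋀[B]^n Ω[B⁄R]

/-- The exterior product `η ∧ θ` of two elements of `Ω_{B/R}`. -/
def wedge : Ω[B⁄R] →ₗ[R] Ω[B⁄R] →ₗ[R] KForm R B 2 :=
  LinearMap.mk₂ R (fun η θ => exteriorPower.ιMulti B 2 ![η, θ])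
    (fun a b c => (exteriorPower.ιMulti B 2 (M := Ω[B⁄R])).map_vecCons_add ![c] a b)
    (fun r a b => by
      have h := (exteriorPower.ιMulti B 2 (M := Ω[B⁄R])).map_vecCons_smul ![b] (algebraMap R B r) a
      simpa only [algebraMap_smul] using h)
    (fun a b c => by
      have h := (exteriorPower.ιMulti B 2 (M := Ω[B⁄R])).map_update_add ![a, 0] 1 b c
      have e : ∀ z, Function.update ![a, 0] 1 z = ![a, z] := fun z => by
        funext i; fin_cases i <;> rfl
      simpa only [e] using h)
    (fun r a b => by
      have h := (exteriorPower.ιMulti B 2 (M := Ω[B⁄R])).map_update_smul ![a, 0] 1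
        (algebraMap R B r) b
      have e : ∀ z, Function.update ![a, 0] 1 z = ![a, z] := fun z => by
        funext i; fin_cases i <;> rfl
      simpa only [algebraMap_smul, e] using h)

theorem wedge_smul_left (b : B) (η θ : Ω[B⁄R]) : wedge R B (b • η) θ = b • wedge R B η θ :=
  (exteriorPower.ιMulti B 2 (M := Ω[B⁄R])).map_vecCons_smul ![θ] b η

theorem wedge_self (η : Ω[B⁄R]) : wedge R B η η = 0 :=
  (exteriorPower.ιMulti B 2 (M := Ω[B⁄R])).map_eq_zero_of_eq ![η, η] (i := 0) (j := 1) rfl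
    (by decide)

theorem wedge_add_swap (η θ : Ω[B⁄R]) : wedge R B η θ + wedge R B θ η = 0 := by
  have h := wedge_self R B (η + θ)
  simp only [map_add, LinearMap.add_apply, wedge_self, zero_add, add_zero] at h
  rwa [add_comm]

theorem wedge_smul_right (b : B) (η θ : Ω[B⁄R]) : wedge R B η (b • θ) = b • wedge R B η θ := by
  rw [eq_neg_of_add_eq_zero_left (wedge_add_swap R B η (b • θ)), wedge_smul_left,
    eq_neg_of_add_eq_zero_left (wedge_add_swap R B η θ), smul_neg]

/-- The map `a ⊗ b ↦ da ∧ db`. -/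
def dTensor : B ⊗[R] B →ₗ[R] KForm R B 2 :=
  TensorProduct.lift ((wedge R B).compl₁₂ (KaehlerDifferential.DLinearMap R B)
    (KaehlerDifferential.DLinearMap R B))

theorem dTensor_tmul (a b : B) :
    dTensor R B (a ⊗ₜ b) =
      wedge R B (KaehlerDifferential.D R B a) (KaehlerDifferential.D R B b) := rfl

theorem dTensor_mul (x y : KaehlerDifferential.ideal R B) :
    dTensor R B ((x : B ⊗[R] B) * y) = 0 := by
  have key : ∀ z ∈ KaehlerDifferential.ideal R B,
      z ∈ Submodule.span B (Set.range fun s : B => (1 : B) ⊗ₜ[R] s - s ⊗ₜ[R] (1 : B)) := by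
    intro z hz
    rw [KaehlerDifferential.submodule_span_range_eq_ideal]; exact hz
  suffices H : ∀ x ∈ Submodule.span B (Set.range fun s : B => (1 : B) ⊗ₜ[R] s - s ⊗ₜ[R] (1 : B)),
      ∀ y ∈ Submodule.span B (Set.range fun s : B => (1 : B) ⊗ₜ[R] s - s ⊗ₜ[R] (1 : B)),
      ∀ c : B, dTensor R B (c • (x * y)) = 0 by
    simpa using H _ (key _ x.2) _ (key _ y.2) 1
  intro x hx y hy
  induction hx using Submodule.span_induction with
  | zero => simp
  | add x x' _ _ h h' =>
    intro c
    rw [add_mul, smul_add, map_add, h, h', add_zero]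
  | smul a x _ h =>
    intro c
    rw [smul_mul_assoc, smul_smul]
    exact h _
  | mem x hx =>
    induction hy using Submodule.span_induction with
    | zero => simp
    | add x x' _ _ h h' =>
      intro c
      rw [mul_add, smul_add, map_add, h, h', add_zero]
    | smul a x _ h =>
      intro c
      rw [mul_smul_comm, smul_smul]
      exact h _
    | mem y hy =>
      obtain ⟨s, rfl⟩ := hx
      obtain ⟨t, rfl⟩ := hy
      intro c
      have e : c • (((1 : B) ⊗ₜ[R] s - s ⊗ₜ[R] (1 : B)) * ((1 : B) ⊗ₜ[R] t - t ⊗ₜ[R] (1 : B))) =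
          c ⊗ₜ[R] (s * t) - (c * t) ⊗ₜ[R] s - (c * s) ⊗ₜ[R] t + (c * s * t) ⊗ₜ[R] (1 : B) := by
        simp only [sub_mul, mul_sub, Algebra.TensorProduct.tmul_mul_tmul, smul_sub,
          TensorProduct.smul_tmul', smul_eq_mul, mul_one, one_mul, mul_assoc]
        abel
      rw [e]
      simp only [map_add, map_sub, dTensor_tmul, Derivation.leibniz, wedge_smul_left,
        wedge_smul_right, LinearMap.add_apply, Derivation.map_one_eq_zero, map_zero,
        smul_add, smul_smul]
      rw [eq_neg_of_add_eq_zero_left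
        (wedge_add_swap R B (KaehlerDifferential.D R B t) (KaehlerDifferential.D R B s))]
      module

/-- The exterior derivative `Ω_{B/R} → Ω²_{B/R}`, `a db ↦ da ∧ db`, where `Ω_{B/R} = J/J²` for the
ideal `J` of the diagonal and `a db` is the class of `a ⊗ b - ab ⊗ 1`. -/
def dOne : Ω[B⁄R] →ₗ[R] KForm R B 2 :=
  Ideal.Cotangent.lift
    ((dTensor R B).comp ((KaehlerDifferential.ideal R B).subtype.restrictScalars R))
    (dTensor_mul R B)

theorem dOne_smul_D (a b : B) :
    dOne R B (a • KaehlerDifferential.D R B b) =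
      wedge R B (KaehlerDifferential.D R B a) (KaehlerDifferential.D R B b) := by
  have h : a • KaehlerDifferential.D R B b = (KaehlerDifferential.ideal R B).toCotangent
      (a • ⟨(1 : B) ⊗ₜ[R] b - b ⊗ₜ[R] (1 : B),
        KaehlerDifferential.one_smul_sub_smul_one_mem_ideal R b⟩) := by
    rfl
  rw [h]
  change dTensor R B (a • ((1 : B) ⊗ₜ[R] b - b ⊗ₜ[R] (1 : B))) = _
  simp [smul_sub, TensorProduct.smul_tmul', dTensor_tmul]

/-- The exterior derivative on `1`-forms, `Ω¹_{B/R}` being the first exterior power. -/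
def dForm : KForm R B 1 →ₗ[R] KForm R B 2 :=
  (dOne R B).comp ((exteriorPower.oneEquiv B Ω[B⁄R]).toLinearMap.restrictScalars R)

/-- The exterior product of two `1`-forms. -/
def wedgeOne : KForm R B 1 →ₗ[R] KForm R B 1 →ₗ[R] KForm R B 2 :=
  (wedge R B).compl₁₂ ((exteriorPower.oneEquiv B Ω[B⁄R]).toLinearMap.restrictScalars R)
    ((exteriorPower.oneEquiv B Ω[B⁄R]).toLinearMap.restrictScalars R)

theorem wedgeOne_swap (η θ : KForm R B 1) : wedgeOne R B η θ + wedgeOne R B θ η = 0 :=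
  wedge_add_swap R B _ _

/-- On a decomposable `Y ⊗ η`, with values in the dual of `L`, post-composition with the exterior
derivative is `Y ⊗ η ↦ Y ⊗ dη`. -/
theorem dForm_comp_dualTensorHom (L : Type u) [AddCommGroup L] [Module R L]
    (Y : Module.Dual R L) (η : KForm R B 1) :
    (dForm R B).comp (dualTensorHom R L (KForm R B 1) (Y ⊗ₜ η)) =
      dualTensorHom R L (KForm R B 2) (Y ⊗ₜ dForm R B η) := by
  ext l
  simp [dualTensorHom_apply]

section Restrict

variable (R' B' : Type u) [CommRing R'] [CommRing B'] [Algebra R' B']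
  [Algebra R R'] [Algebra B B'] [Algebra R B'] [IsScalarTower R R' B'] [IsScalarTower R B B']

/-- Functoriality of differential forms for a commutative square of algebras,
`c db₁ ∧ ... ∧ dbₙ` being sent to the form with the same name. -/
def KForm.mapAlg (n : ℕ) : KForm R B n →ₗ[B] KForm R' B' n :=
  exteriorPower.alternatingMapLinearEquiv
    { toFun := fun m => exteriorPower.ιMulti B' n (fun i => KaehlerDifferential.map R R' B B' (m i))
      map_update_add' := fun m i x y => by
        simp only [Function.apply_update (fun _ => KaehlerDifferential.map R R' B B') m]
        rw [map_add, AlternatingMap.map_update_add]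
      map_update_smul' := fun m i c x => by
        simp only [Function.apply_update (fun _ => KaehlerDifferential.map R R' B B') m]
        rw [map_smul, ← algebraMap_smul B' c, AlternatingMap.map_update_smul, algebraMap_smul]
      map_eq_zero_of_eq' := fun m i j h hij =>
        AlternatingMap.map_eq_zero_of_eq _ _ (by rw [h]) hij }

end Restrict

variable {R B} in
/-- Functoriality of differential forms for a commutative square of ring homomorphisms. -/
def KForm.map {R' B' : Type u} [CommRing R'] [CommRing B'] [Algebra R' B']
    (ρ : R →+* R') (β : B →+* B') (h : β.comp (algebraMap R B) = (algebraMap R' B').comp ρ)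
    (n : ℕ) : KForm R B n →+ KForm R' B' n :=
  letI := ρ.toAlgebra
  letI := β.toAlgebra
  letI := (β.comp (algebraMap R B)).toAlgebra
  haveI : IsScalarTower R R' B' := IsScalarTower.of_algebraMap_eq' h
  haveI : IsScalarTower R B B' := IsScalarTower.of_algebraMap_eq' rfl
  (KForm.mapAlg R B R' B' n).toAddMonoidHom

variable {R B} in
theorem KForm.map_smul_ιMulti {R' B' : Type u} [CommRing R'] [CommRing B'] [Algebra R' B']
    (ρ : R →+* R') (β : B →+* B') (h : β.comp (algebraMap R B) = (algebraMap R' B').comp ρ)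
    (n : ℕ) (c : B) (b : Fin n → B) :
    KForm.map ρ β h n (c • exteriorPower.ιMulti B n fun i => KaehlerDifferential.D R B (b i)) =
      β c • exteriorPower.ιMulti B' n fun i => KaehlerDifferential.D R' B' (β (b i)) := by
  let _ := ρ.toAlgebra
  let _ := β.toAlgebra
  let _ := (β.comp (algebraMap R B)).toAlgebra
  have : IsScalarTower R R' B' := IsScalarTower.of_algebraMap_eq' h
  have : IsScalarTower R B B' := IsScalarTower.of_algebraMap_eq' rfl
  change KForm.mapAlg R B R' B' n _ = _
  rw [map_smul, KForm.mapAlg, exteriorPower.alternatingMapLinearEquiv_apply_ιMulti]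
  simp only [AlternatingMap.coe_mk, MultilinearMap.coe_mk, KaehlerDifferential.map_D]
  rw [← algebraMap_smul B' c]
  rfl

variable {B}
/-- The conditions that make the points `x₀, ..., xₙ` of `Spec B` with values in `C` the vertices of
an infinitesimal `n`-simplex: `xᵢ` and `xⱼ` agree modulo an ideal of square zero (`sq`), and
moreover `(xᵢ b - x₀ b) (xⱼ b - x₀ b) = 0` for all `b` (`strong`, automatic from `sq` when `2` is
invertible). -/
structure IsInfClose {C : Type u} [CommRing C] {n : ℕ} (x : Fin (n + 1) → B →+* C) : Prop where
  sq : ∀ i j b b', (x i b - x j b) * (x i b' - x j b') = 0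
  strong : ∀ i j b, (x i b - x 0 b) * (x j b - x 0 b) = 0

variable {R} {C : Type u} [CommRing C] {n : ℕ} {x : Fin (n + 1) → B →+* C}

/-- The difference `xᵢ - x₀`, a derivation of `B` with values in `C`, viewed as a `B`-module
through `x₀`. -/
def diffDer (hx : IsInfClose x) (hR : ∀ i r, x i (algebraMap R B r) = x 0 (algebraMap R B r))
    (i : Fin (n + 1)) :
    letI := ((x 0).comp (algebraMap R B)).toAlgebra
    letI := (x 0).toAlgebra
    Derivation R B C :=
  letI := ((x 0).comp (algebraMap R B)).toAlgebra
  letI := (x 0).toAlgebra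
  Derivation.mk'
    { toFun := fun b => x i b - x 0 b
      map_add' := fun b b' => by simp only [map_add]; ring
      map_smul' := fun r b => by
        simp only [Algebra.smul_def, map_mul, hR, RingHom.id_apply, RingHom.algebraMap_toAlgebra,
          RingHom.comp_apply]
        ring }
    (fun b b' => by
      have h := hx.sq i 0 b b'
      simp only [LinearMap.coe_mk, AddHom.coe_mk, Algebra.smul_def, map_mul,
        RingHom.algebraMap_toAlgebra]
      linear_combination h)

theorem diff_mul_self (hx : IsInfClose x)
    (hR : ∀ i r, x i (algebraMap R B r) = x 0 (algebraMap R B r)) (i j : Fin (n + 1))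
    (η : Ω[B⁄R]) :
    letI := ((x 0).comp (algebraMap R B)).toAlgebra
    letI := (x 0).toAlgebra
    haveI : IsScalarTower R B C := IsScalarTower.of_algebraMap_eq' rfl
    (diffDer hx hR i).liftKaehlerDifferential η * (diffDer hx hR j).liftKaehlerDifferential η
      = 0 := by
  let _ := ((x 0).comp (algebraMap R B)).toAlgebra
  let _ := (x 0).toAlgebra
  have : IsScalarTower R B C := IsScalarTower.of_algebraMap_eq' rfl
  have hpol : ∀ b b' : B, (x i b - x 0 b) * (x j b' - x 0 b') +
      (x i b' - x 0 b') * (x j b - x 0 b) = 0 := fun b b' => by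
    have h := hx.strong i j (b + b')
    simp only [map_add] at h
    linear_combination h - hx.strong i j b - hx.strong i j b'
  set f := (diffDer hx hR i).liftKaehlerDifferential
  set g := (diffDer hx hR j).liftKaehlerDifferential
  have hf : ∀ b, f (KaehlerDifferential.D R B b) = x i b - x 0 b := fun b =>
    Derivation.liftKaehlerDifferential_comp_D _ b
  have hg : ∀ b, g (KaehlerDifferential.D R B b) = x j b - x 0 b := fun b =>
    Derivation.liftKaehlerDifferential_comp_D _ b
  have hη : η ∈ Submodule.span B (Set.range (KaehlerDifferential.D R B)) := by
    rw [KaehlerDifferential.span_range_derivation]; trivial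
  have hpol2 : ∀ b : B, ∀ θ ∈ Submodule.span B (Set.range (KaehlerDifferential.D R B)),
      f (KaehlerDifferential.D R B b) * g θ + f θ * g (KaehlerDifferential.D R B b) = 0 := by
    intro b θ hθ
    induction hθ using Submodule.span_induction with
    | zero => simp
    | add θ θ' _ _ h h' =>
      simp only [map_add]
      linear_combination h + h'
    | smul c θ _ h =>
      simp only [map_smul, Algebra.smul_def]
      linear_combination algebraMap B C c * h
    | mem θ hθ =>
      obtain ⟨b', rfl⟩ := hθ
      simp only [hf, hg]
      exact hpol b b'
  have hpol3 : ∀ θ' ∈ Submodule.span B (Set.range (KaehlerDifferential.D R B)),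
      ∀ θ ∈ Submodule.span B (Set.range (KaehlerDifferential.D R B)),
      f θ' * g θ + f θ * g θ' = 0 := by
    intro θ' hθ' θ hθ
    induction hθ' using Submodule.span_induction with
    | zero => simp
    | add θ θ' _ _ h h' =>
      simp only [map_add]
      linear_combination h + h'
    | smul c θ _ h =>
      simp only [map_smul, Algebra.smul_def]
      linear_combination algebraMap B C c * h
    | mem θ' hθ' =>
      obtain ⟨b', rfl⟩ := hθ'
      exact hpol2 b' θ hθ
  induction hη using Submodule.span_induction with
  | zero => simp
  | add θ θ' m m' h h' =>
    simp only [map_add]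
    linear_combination h + h' + hpol3 _ m _ m'
  | smul c θ _ h =>
    simp only [map_smul, Algebra.smul_def]
    linear_combination algebraMap B C c ^ 2 * h
  | mem θ hθ =>
    obtain ⟨b', rfl⟩ := hθ
    simp only [hf, hg]
    exact hx.strong i j b'

/-- The value of a differential `n`-form on an infinitesimal `n`-simplex:
`c db₁ ∧ ... ∧ dbₙ` takes the value `x₀ c * ∏ i, (xᵢ bᵢ - x₀ bᵢ)`. -/
def evalForm (hx : IsInfClose x)
    (hR : ∀ i r, x i (algebraMap R B r) = x 0 (algebraMap R B r)) : KForm R B n →+ C :=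
  letI := ((x 0).comp (algebraMap R B)).toAlgebra
  letI := (x 0).toAlgebra
  haveI : IsScalarTower R B C := IsScalarTower.of_algebraMap_eq' rfl
  (exteriorPower.alternatingMapLinearEquiv
    { (MultilinearMap.mkPiAlgebra B (Fin n) C).compLinearMap
        (fun i => (diffDer hx hR i.succ).liftKaehlerDifferential) with
      map_eq_zero_of_eq' := fun m i j h hij => by
        have h2 := diff_mul_self hx hR i.succ j.succ (m i)
        change ∏ k, (diffDer hx hR k.succ).liftKaehlerDifferential (m k) = 0
        rw [← Finset.mul_prod_erase _ _ (Finset.mem_univ i),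
          ← Finset.mul_prod_erase _ _ (Finset.mem_erase.2 ⟨hij.symm, Finset.mem_univ j⟩),
          ← mul_assoc, ← h, h2, zero_mul] }).toAddMonoidHom

theorem evalForm_smul_ιMulti (hx : IsInfClose x)
    (hR : ∀ i r, x i (algebraMap R B r) = x 0 (algebraMap R B r)) (c : B) (b : Fin n → B) :
    evalForm hx hR (c • exteriorPower.ιMulti B n fun i => KaehlerDifferential.D R B (b i)) =
      x 0 c * ∏ i : Fin n, (x i.succ (b i) - x 0 (b i)) := by
  let _ := ((x 0).comp (algebraMap R B)).toAlgebra
  let _ := (x 0).toAlgebra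
  have : IsScalarTower R B C := IsScalarTower.of_algebraMap_eq' rfl
  change exteriorPower.alternatingMapLinearEquiv _ _ = _
  rw [map_smul, exteriorPower.alternatingMapLinearEquiv_apply_ιMulti, Algebra.smul_def]
  change x 0 c * ∏ i : Fin n, (diffDer hx hR i.succ).liftKaehlerDifferential
    (KaehlerDifferential.D R B (b i)) = _
  simp only [Derivation.liftKaehlerDifferential_comp_D]
  rfl

end Algebra

section Hopf

variable {R A : Type u} [CommRing R] [CommRing A] [Algebra R A] (ε : A →ₐ[R] R)

/-- The module of invariant differentials `I/I²`, for `I` the augmentation ideal. -/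
abbrev CoLie : Type u := (RingHom.ker ε).Cotangent

/-- The ring `A/I²` of the first infinitesimal neighbourhood of the unit section. -/
abbrev InfOne : Type u := A ⧸ (RingHom.ker ε) ^ 2

/-- The augmentation of `A/I²`. -/
def InfOne.counit : InfOne ε →ₐ[R] R :=
  Ideal.Quotient.liftₐ _ ε fun _ ha => Ideal.pow_le_self two_ne_zero ha

@[simp]
theorem InfOne.counit_mk (a : A) :
    InfOne.counit ε (Ideal.Quotient.mk _ a) = ε a := rfl

theorem InfOne.sub_counit_mem (q : InfOne ε) :
    q - algebraMap R _ (InfOne.counit ε q) ∈ (RingHom.ker ε).cotangentIdeal := by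
  obtain ⟨a, rfl⟩ := Ideal.Quotient.mk_surjective q
  refine (Ideal.mk_mem_cotangentIdeal (x := a - algebraMap R A (ε a))).2 ?_
  simp [RingHom.mem_ker]

/-- The map `q ↦ q - ε(q)` from `A/I²` to its ideal `I/I²`. -/
def InfOne.subCounit : InfOne ε →ₗ[R] (RingHom.ker ε).cotangentIdeal where
  toFun q := ⟨q - algebraMap R _ (InfOne.counit ε q), InfOne.sub_counit_mem ε q⟩
  map_add' q q' := by
    ext; simp only [map_add, Submodule.coe_add]; ring
  map_smul' r q := by
    ext
    change r • q - algebraMap R _ (InfOne.counit ε (r • q)) =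
      r • (q - algebraMap R _ (InfOne.counit ε q))
    rw [map_smul, smul_sub, smul_eq_mul, map_mul, ← Algebra.smul_def]

/-- The projection `a ↦ a - ε(a)` of `A/I² = R ⊕ I/I²` onto `I/I²`. -/
def InfOne.proj : InfOne ε →ₗ[R] CoLie ε :=
  ((RingHom.ker ε).cotangentEquivIdeal.symm.toLinearMap.restrictScalars R).comp
    (InfOne.subCounit ε)

theorem InfOne.proj_mk (a : A) (ha : a - algebraMap R A (ε a) ∈ RingHom.ker ε) :
    InfOne.proj ε (Ideal.Quotient.mk _ a) =
      (RingHom.ker ε).toCotangent ⟨a - algebraMap R A (ε a), ha⟩ := by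
  change (RingHom.ker ε).cotangentEquivIdeal.symm (InfOne.subCounit ε _) = _
  rw [LinearEquiv.symm_apply_eq]
  ext
  simp
  rfl

theorem InfOne.proj_mul (q q' : InfOne ε) :
    InfOne.proj ε (q * q') =
      InfOne.counit ε q • InfOne.proj ε q' + InfOne.counit ε q' • InfOne.proj ε q := by
  obtain ⟨a, rfl⟩ := Ideal.Quotient.mk_surjective q
  obtain ⟨a', rfl⟩ := Ideal.Quotient.mk_surjective q'
  have h : ∀ a : A, a - algebraMap R A (ε a) ∈ RingHom.ker ε := fun a => by simp [RingHom.mem_ker]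
  rw [← map_mul, InfOne.proj_mk ε _ (h _), InfOne.proj_mk ε _ (h _), InfOne.proj_mk ε _ (h _)]
  change _ = ε a • _ + ε a' • _
  have e : ∀ (r : R) (z : RingHom.ker ε), r • (RingHom.ker ε).toCotangent z =
      (RingHom.ker ε).toCotangent (algebraMap R A r • z) := fun r z => by
    rw [map_smul, algebraMap_smul]
  rw [e, e, ← map_add, Ideal.toCotangent_eq]
  have : a * a' - algebraMap R A (ε (a * a')) - ((algebraMap R A (ε a)) * (a' - algebraMap R A (ε a'))
      + (algebraMap R A (ε a')) * (a - algebraMap R A (ε a))) =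
      (a - algebraMap R A (ε a)) * (a' - algebraMap R A (ε a')) := by
    rw [map_mul, map_mul]; ring
  change a * a' - algebraMap R A (ε (a * a')) - ((algebraMap R A (ε a)) * (a' - algebraMap R A (ε a'))
      + (algebraMap R A (ε a')) * (a - algebraMap R A (ε a))) ∈ _
  rw [this, pow_two]
  exact Ideal.mul_mem_mul (h a) (h a')

/-- A comultiplication, restricted to the first infinitesimal neighbourhoods of the unit section in
the two factors, which satisfies both unit laws. The unit laws say that
`μ(z) = z ⊗ 1 + 1 ⊗ z + ∑ αᵢ ⊗ βᵢ` for `z` in `I`, with `αᵢ, βᵢ` in `I`. -/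
structure InfComul where
  toAlgHom : A →ₐ[R] InfOne ε ⊗[R] InfOne ε
  counit_left : (Algebra.TensorProduct.lift ((Algebra.ofId R (InfOne ε)).comp (InfOne.counit ε))
    (AlgHom.id R (InfOne ε)) fun _ _ => Commute.all _ _).comp toAlgHom = Ideal.Quotient.mkₐ R _
  counit_right : (Algebra.TensorProduct.lift (AlgHom.id R (InfOne ε))
    ((Algebra.ofId R (InfOne ε)).comp (InfOne.counit ε)) fun _ _ => Commute.all _ _).comp toAlgHom
    = Ideal.Quotient.mkₐ R _

variable {ε} {B : Type u} [CommRing B] [Algebra R B]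

/-- The map `a ⊗ b ↦ φ(a - ε a) ∧ φ(b - ε b)`. -/
def wedgeExt (φ : CoLie ε →ₗ[R] KForm R B 1) : InfOne ε ⊗[R] InfOne ε →ₗ[R] KForm R B 2 :=
  TensorProduct.lift ((wedgeOne R B).compl₁₂ (φ.comp (InfOne.proj ε)) (φ.comp (InfOne.proj ε)))

theorem wedgeExt_mul (φ : CoLie ε →ₗ[R] KForm R B 1) (u v : InfOne ε ⊗[R] InfOne ε) :
    wedgeExt φ (u * v) =
      (Algebra.TensorProduct.lift (InfOne.counit ε) (InfOne.counit ε) fun _ _ => Commute.all _ _) u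
        • wedgeExt φ v
      + (Algebra.TensorProduct.lift (InfOne.counit ε) (InfOne.counit ε) fun _ _ => Commute.all _ _) v
        • wedgeExt φ u
      + wedgeOne R B
        (φ (InfOne.proj ε ((Algebra.TensorProduct.lift (AlgHom.id R (InfOne ε))
          ((Algebra.ofId R (InfOne ε)).comp (InfOne.counit ε)) fun _ _ => Commute.all _ _) v)))
        (φ (InfOne.proj ε ((Algebra.TensorProduct.lift ((Algebra.ofId R (InfOne ε)).comp
          (InfOne.counit ε)) (AlgHom.id R (InfOne ε)) fun _ _ => Commute.all _ _) u)))
      + wedgeOne R B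
        (φ (InfOne.proj ε ((Algebra.TensorProduct.lift (AlgHom.id R (InfOne ε))
          ((Algebra.ofId R (InfOne ε)).comp (InfOne.counit ε)) fun _ _ => Commute.all _ _) u)))
        (φ (InfOne.proj ε ((Algebra.TensorProduct.lift ((Algebra.ofId R (InfOne ε)).comp
          (InfOne.counit ε)) (AlgHom.id R (InfOne ε)) fun _ _ => Commute.all _ _) v))) := by
  induction u with
  | zero => simp
  | add u u' h h' =>
    simp only [add_mul, map_add, h, h', add_smul, smul_add, LinearMap.add_apply]
    abel
  | tmul a b =>
    induction v with
    | zero => simp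
    | add v v' h h' =>
      simp only [mul_add, map_add, h, h', add_smul, smul_add, LinearMap.add_apply]
      abel
    | tmul a' b' =>
      have e1 : ∀ (r : R) (q : InfOne ε),
          InfOne.proj ε (q * algebraMap R _ r) = r • InfOne.proj ε q := fun r q => by
        rw [mul_comm, ← Algebra.smul_def, map_smul]
      have e2 : ∀ (r : R) (q : InfOne ε),
          InfOne.proj ε (algebraMap R _ r * q) = r • InfOne.proj ε q := fun r q => by
        rw [← Algebra.smul_def, map_smul]
      simp only [Algebra.TensorProduct.tmul_mul_tmul, wedgeExt, TensorProduct.lift.tmul,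
        LinearMap.compl₁₂_apply, LinearMap.comp_apply, InfOne.proj_mul, map_add, map_smul,
        LinearMap.add_apply, LinearMap.smul_apply, Algebra.TensorProduct.lift_tmul,
        AlgHom.comp_apply, AlgHom.coe_id, id_eq, Algebra.ofId_apply, e1, e2, smul_add, smul_smul]
      module

/-- The quadratic operation `φ ↦ [φ]^{(2)}` on maps `φ : I/I² → Ω¹_{B/R}`: it sends the class of `z` to
`∑ φ(αᵢ) ∧ φ(βᵢ)` whenever `μ(z) = z ⊗ 1 + 1 ⊗ z + ∑ αᵢ ⊗ βᵢ` with `αᵢ, βᵢ` in `I`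
(see `sqForm_eq_sum`). -/
def sqForm (μ : InfComul ε) (φ : CoLie ε →ₗ[R] KForm R B 1) : CoLie ε →ₗ[R] KForm R B 2 :=
  Ideal.Cotangent.lift
    (((wedgeExt φ).comp μ.toAlgHom.toLinearMap).comp
      ((RingHom.ker ε).subtype.restrictScalars R)) <| by
    intro z z'
    have hl : ∀ a, _ = _ := fun a => DFunLike.congr_fun μ.counit_left a
    have hr : ∀ a, _ = _ := fun a => DFunLike.congr_fun μ.counit_right a
    have hlr : ∀ u : InfOne ε ⊗[R] InfOne ε,
        (Algebra.TensorProduct.lift (InfOne.counit ε) (InfOne.counit ε)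
          fun _ _ => Commute.all _ _) u =
        InfOne.counit ε ((Algebra.TensorProduct.lift ((Algebra.ofId R (InfOne ε)).comp
          (InfOne.counit ε)) (AlgHom.id R (InfOne ε)) fun _ _ => Commute.all _ _) u) := by
      intro u
      induction u with
      | zero => simp
      | add u u' h h' => simp only [map_add, h, h']
      | tmul a b => simp [Algebra.ofId_apply]
    have h0 : ∀ z : RingHom.ker ε, InfOne.counit ε (Ideal.Quotient.mkₐ R _ (z : A)) = 0 :=
      fun z => z.2
    change wedgeExt φ (μ.toAlgHom (z * z')) = 0
    simp only [AlgHom.comp_apply] at hl hr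
    rw [map_mul, wedgeExt_mul, hlr, hlr, hl, hl, hr, hr, h0, h0, zero_smul, zero_smul, zero_add,
      zero_add, wedgeOne_swap]

theorem sqForm_toCotangent (μ : InfComul ε) (φ : CoLie ε →ₗ[R] KForm R B 1) (z : RingHom.ker ε) :
    sqForm μ φ ((RingHom.ker ε).toCotangent z) = wedgeExt φ (μ.toAlgHom z) := rfl

theorem sqForm_eq_sum (μ : InfComul ε) (φ : CoLie ε →ₗ[R] KForm R B 1) (z : RingHom.ker ε)
    {ι : Type*} (s : Finset ι) (α β : ι → RingHom.ker ε)
    (h : μ.toAlgHom z = Ideal.Quotient.mk _ (z : A) ⊗ₜ 1 + 1 ⊗ₜ Ideal.Quotient.mk _ (z : A) +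
      ∑ i ∈ s, Ideal.Quotient.mk _ (α i : A) ⊗ₜ Ideal.Quotient.mk _ (β i : A)) :
    sqForm μ φ ((RingHom.ker ε).toCotangent z) =
      ∑ i ∈ s, wedgeOne R B (φ ((RingHom.ker ε).toCotangent (α i)))
        (φ ((RingHom.ker ε).toCotangent (β i))) := by
  have h1 : InfOne.proj ε 1 = 0 := by
    have := InfOne.proj_mul ε 1 1
    simpa using this
  have h2 : ∀ z : RingHom.ker ε, InfOne.proj ε (Ideal.Quotient.mk _ (z : A)) =
      (RingHom.ker ε).toCotangent z := fun z => by
    have hz : ε z = 0 := z.2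
    rw [InfOne.proj_mk ε _ (by simp [RingHom.mem_ker])]
    congr 1
    ext
    simp [hz]
  rw [sqForm_toCotangent, h]
  simp [wedgeExt, h1, h2]

end Hopf

section Geometry

open CategoryTheory AlgebraicGeometry MonoidalCategory CartesianMonoidalCategory MonObj

variable {S : Scheme.{u}}

/-- The `n + 1` points `xᵢ` of the relative scheme `X/S` with values in `T` form an infinitesimal
`n`-simplex, that is a `T`-point of the scheme `Δⁿ_{X/S}`: they coincide topologically, and on each
affine open `U` of `X` they are close in the sense of `IsInfClose`. -/
structure IsInfSimplex {X T : Over S} {n : ℕ} (x : Fin (n + 1) → (T ⟶ X)) : Prop where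
  base : ∀ i (t : T.left), (x i).left t = (x 0).left t
  close : ∀ (U : X.left.Opens), IsAffineOpen U → ∀ (W : T.left.Opens)
    (hW : ∀ i, W ≤ (x i).left ⁻¹ᵁ U), IsInfClose fun i => ((x i).left.appLE U W (hW i)).hom

theorem IsInfSimplex.precomp {X T T' : Over S} {n : ℕ} {x : Fin (n + 1) → (T ⟶ X)}
    (hx : IsInfSimplex x) (h : T' ⟶ T) : IsInfSimplex fun i => h ≫ x i where
  base i t := by
    simp only [Over.comp_left, Scheme.Hom.comp_apply]
    exact hx.base i _
  close U hU W hW := by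
    have h1 : ∀ i, (x 0).left ⁻¹ᵁ U ≤ (x i).left ⁻¹ᵁ U := fun i t ht => by
      change (x i).left t ∈ U
      rw [hx.base i t]; exact ht
    have h2 : W ≤ h.left ⁻¹ᵁ ((x 0).left ⁻¹ᵁ U) := hW 0
    have h3 := hx.close U hU _ h1
    have e : ∀ i b, ((h ≫ x i).left.appLE U W (hW i)).hom b =
        (h.left.appLE _ W h2).hom (((x i).left.appLE U _ (h1 i)).hom b) := fun i b => by
      rw [← CommRingCat.comp_apply, Scheme.Hom.appLE_comp_appLE]
      rfl
    constructor
    · intro i j b b'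
      simp only [e, ← map_sub, ← map_mul, h3.sq, map_zero]
    · intro i j b
      simp only [e, ← map_sub, ← map_mul, h3.strong, map_zero]

theorem IsInfSimplex.reindex {X T : Over S} {n m : ℕ} {x : Fin (n + 1) → (T ⟶ X)}
    (hx : IsInfSimplex x) (σ : Fin (m + 1) → Fin (n + 1)) : IsInfSimplex (x ∘ σ) where
  base i t := by simp only [Function.comp_apply, hx.base (σ i), hx.base (σ 0)]
  close U hU W hW := by
    have h1 : ∀ i, W ≤ (x i).left ⁻¹ᵁ U := fun i t ht => by
      have h2 : (x (σ 0)).left t ∈ U := hW 0 ht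
      change (x i).left t ∈ U
      rw [hx.base i t, ← hx.base (σ 0) t]; exact h2
    have h3 := hx.close U hU W h1
    constructor
    · intro i j b b'
      exact h3.sq (σ i) (σ j) b b'
    · intro i j b
      have a1 := h3.strong (σ i) (σ j) b
      have a2 := h3.strong (σ i) (σ 0) b
      have a3 := h3.strong (σ 0) (σ j) b
      have a4 := h3.strong (σ 0) (σ 0) b
      simp only [Function.comp_apply] at *
      linear_combination a1 - a2 - a3 + a4

/-- A morphism of `S`-schemes `Δⁿ_{X/S} → G`, described on points: a natural rule that sends each
infinitesimal `n`-simplex of `X` with values in `T` to a `T`-point of `G`. -/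
structure CombFun (X G : Over S) (n : ℕ) where
  val : ∀ {T : Over S} (x : Fin (n + 1) → (T ⟶ X)), IsInfSimplex x → (T ⟶ G)
  natural : ∀ {T T' : Over S} (h : T' ⟶ T) (x : Fin (n + 1) → (T ⟶ X)) (hx : IsInfSimplex x),
    val (fun i => h ≫ x i) (hx.precomp h) = h ≫ val x hx

variable {X G : Over S} [GrpObj G]

/-- The constant morphism with value the unit of `G`. -/
instance (n : ℕ) : One (CombFun X G n) where
  one :=
    { val := fun _ _ => 1
      natural := fun h _ _ => (MonObj.comp_one h).symm }

/-- A `G`-valued combinatorial `n`-form: a morphism `Δⁿ_{X/S} → G` that takes the value `1` on a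
simplex as soon as two consecutive vertices coincide. -/
def CombFun.IsForm {n : ℕ} (f : CombFun X G n) : Prop :=
  ∀ {T : Over S} (x : Fin (n + 1) → (T ⟶ X)) (hx : IsInfSimplex x) (i : Fin n),
    x i.castSucc = x i.succ → f.val x hx = 1

/-- The combinatorial differential `δ⁰g(x₀, x₁) = g(x₀)⁻¹ g(x₁)`. -/
def deltaZero (g : X ⟶ G) : CombFun X G 1 where
  val x _ := (x 0 ≫ g)⁻¹ * (x 1 ≫ g)
  natural h x _ := by
    rw [MonObj.comp_mul, GrpObj.comp_inv, Category.assoc, Category.assoc]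

/-- The combinatorial differential `δ¹ω(x₀, x₁, x₂) = ω(x₀, x₁) ω(x₁, x₂) ω(x₂, x₀)`. -/
def deltaOne (ω : CombFun X G 1) : CombFun X G 2 where
  val x hx := ω.val (x ∘ ![0, 1]) (hx.reindex _) * ω.val (x ∘ ![1, 2]) (hx.reindex _) *
    ω.val (x ∘ ![2, 0]) (hx.reindex _)
  natural h x _ := by
    simp only [MonObj.comp_mul, ← ω.natural]
    rfl

variable (G) in
/-- The unit section of the group scheme. -/
def unitSection : S ⟶ G.left := (η[G] : 𝟙_ (Over S) ⟶ G).left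

theorem unitSection_comp : unitSection G ≫ G.hom = 𝟙 S := Over.w (η[G] : 𝟙_ (Over S) ⟶ G)

theorem unitSection_appLE {V : S.Opens} {W : G.left.Opens} (hW : W ≤ G.hom ⁻¹ᵁ V)
    (hV : V ≤ unitSection G ⁻¹ᵁ W) (r : Γ(S, V)) :
    ((unitSection G).appLE W V hV).hom ((G.hom.appLE V W hW).hom r) = r := by
  rw [← CommRingCat.comp_apply, Scheme.Hom.appLE_comp_appLE]
  have : ∀ (f : S ⟶ S) (_ : f = 𝟙 S) (h : V ≤ f ⁻¹ᵁ V), f.appLE V V h = 𝟙 _ := by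
    rintro _ rfl h
    exact (Category.id_comp _).trans (S.presheaf.map_id _)
  rw [this _ unitSection_comp]
  rfl

variable (X G) in
/-- Affine opens `V ⊆ S`, `U ⊆ X` over `V`, and `W ⊆ G` over `V` that contains the unit section over
`V`. -/
structure Chart where
  V : S.Opens
  U : X.left.Opens
  W : G.left.Opens
  affV : IsAffineOpen V
  affU : IsAffineOpen U
  affW : IsAffineOpen W
  leU : U ≤ X.hom ⁻¹ᵁ V
  leW : W ≤ G.hom ⁻¹ᵁ V
  unit_le : V ≤ unitSection G ⁻¹ᵁ W

namespace Chart

variable (c : Chart X G)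

/-- The ring of functions on the open of the base. -/
abbrev R : Type u := Γ(S, c.V)
/-- The ring of functions on the open of `X`. -/
abbrev B : Type u := Γ(X.left, c.U)
/-- The ring of functions on the open of `G`. -/
abbrev A : Type u := Γ(G.left, c.W)

instance : Algebra c.R c.B := (X.hom.appLE c.V c.U c.leU).hom.toAlgebra
instance : Algebra c.R c.A := (G.hom.appLE c.V c.W c.leW).hom.toAlgebra

/-- Evaluation of functions along the unit section. -/
def counit : c.A →ₐ[c.R] c.R :=
  { ((unitSection G).appLE c.W c.V c.unit_le).hom with
    commutes' := unitSection_appLE c.leW c.unit_le }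

/-- The ideal of the unit section. -/
abbrev I : Ideal c.A := RingHom.ker c.counit
/-- The sections over the open of the base of `ω_{G/S}`, the conormal sheaf of the unit section of
`G`. Its dual is `Lie(G)`. -/
abbrev coLie : Type u := CoLie c.counit

variable (C : Type u) [CommRing C] [Algebra c.R C]

/-- The spectrum of an algebra over the functions on the open of the base, as an `S`-scheme. -/
def spec : Over S :=
  Over.mk (Spec.map (CommRingCat.ofHom (algebraMap c.R C)) ≫ c.affV.fromSpec)

variable {C} in
/-- The point of `G` given by an algebra map on functions. -/
def pt (α : c.A →ₐ[c.R] C) : c.spec C ⟶ G :=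
  Over.homMk (Spec.map (CommRingCat.ofHom α.toRingHom) ≫ c.affW.fromSpec) <| by
    change (Spec.map (CommRingCat.ofHom α.toRingHom) ≫ c.affW.fromSpec) ≫ G.hom =
      Spec.map (CommRingCat.ofHom (algebraMap c.R C)) ≫ c.affV.fromSpec
    have h : CommRingCat.ofHom (algebraMap c.R C) =
        G.hom.appLE c.V c.W c.leW ≫ CommRingCat.ofHom α.toRingHom := by
      ext r
      exact (α.commutes r).symm
    rw [Category.assoc, h, Spec.map_comp, Category.assoc,
      IsAffineOpen.SpecMap_appLE_fromSpec _ c.affV c.affW c.leW]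

variable {C} {D : Type u} [CommRing D] [Algebra c.R D]

/-- The map of spectra given by an algebra map. -/
def specMap (f : C →ₐ[c.R] D) : c.spec D ⟶ c.spec C :=
  Over.homMk (Spec.map (CommRingCat.ofHom f.toRingHom)) <| by
    change Spec.map (CommRingCat.ofHom f.toRingHom) ≫
      Spec.map (CommRingCat.ofHom (algebraMap c.R C)) ≫ c.affV.fromSpec =
      Spec.map (CommRingCat.ofHom (algebraMap c.R D)) ≫ c.affV.fromSpec
    rw [← Category.assoc, ← Spec.map_comp]
    congr 2
    ext r
    exact f.commutes r

theorem specMap_pt (f : C →ₐ[c.R] D) (α : c.A →ₐ[c.R] C) :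
    c.specMap f ≫ c.pt α = c.pt (f.comp α) := by
  ext1
  change Spec.map (CommRingCat.ofHom f.toRingHom) ≫
    Spec.map (CommRingCat.ofHom α.toRingHom) ≫ c.affW.fromSpec =
      Spec.map (CommRingCat.ofHom (f.comp α).toRingHom) ≫ c.affW.fromSpec
  rw [← Category.assoc, ← Spec.map_comp]
  rfl

theorem pt_injective : Function.Injective (c.pt (C := C)) := by
  intro α β h
  have h1 : Spec.map (CommRingCat.ofHom α.toRingHom) ≫ c.affW.fromSpec =
      Spec.map (CommRingCat.ofHom β.toRingHom) ≫ c.affW.fromSpec :=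
    congrArg (fun f : c.spec C ⟶ G => f.left) h
  rw [cancel_mono] at h1
  have h2 := congrArg CommRingCat.Hom.hom (Spec.map_injective h1)
  ext a
  exact DFunLike.congr_fun h2 a

theorem pt_counit : c.pt ((Algebra.ofId c.R C).comp c.counit) = 1 := by
  ext1
  have h : (1 : c.spec C ⟶ G).left = (c.spec C).hom ≫ unitSection G := by
    rw [Hom.one_def]
    simp [unitSection]
  rw [h]
  change Spec.map (CommRingCat.ofHom ((Algebra.ofId c.R C).comp c.counit).toRingHom) ≫
    c.affW.fromSpec = (Spec.map (CommRingCat.ofHom (algebraMap c.R C)) ≫ c.affV.fromSpec) ≫ _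
  have h2 : CommRingCat.ofHom ((Algebra.ofId c.R C).comp c.counit).toRingHom =
      (unitSection G).appLE c.W c.V c.unit_le ≫ CommRingCat.ofHom (algebraMap c.R C) := rfl
  rw [h2, Spec.map_comp, Category.assoc, Category.assoc,
    IsAffineOpen.SpecMap_appLE_fromSpec _ c.affW c.affV c.unit_le]

theorem exists_pt (p : c.spec C ⟶ G) (f : C →ₐ[c.R] D)
    (hf : Function.Surjective (PrimeSpectrum.comap f.toRingHom)) (δ : c.A →ₐ[c.R] D)
    (h : c.specMap f ≫ p = c.pt δ) : ∃ α : c.A →ₐ[c.R] C, c.pt α = p := by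
  have hr : Set.range p.left ⊆ Set.range c.affW.fromSpec := by
    rintro _ ⟨y, rfl⟩
    obtain ⟨y, rfl⟩ := hf y
    have h1 : (c.specMap f ≫ p).left y = (c.pt δ).left y := by rw [h]
    exact ⟨(Spec.map (CommRingCat.ofHom δ.toRingHom)) y, h1.symm⟩
  let q : Spec (.of C) ⟶ Spec (.of c.A) := IsOpenImmersion.lift c.affW.fromSpec p.left hr
  have hq : q ≫ c.affW.fromSpec = p.left := IsOpenImmersion.lift_fac _ _ _
  obtain ⟨g, hg⟩ : ∃ g : CommRingCat.of c.A ⟶ CommRingCat.of C, Spec.map g = q :=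
    ⟨Spec.preimage q, Spec.map_preimage q⟩
  have hw : (Spec.map g ≫ c.affW.fromSpec) ≫ G.hom =
      Spec.map (CommRingCat.ofHom (algebraMap c.R C)) ≫ c.affV.fromSpec := by
    rw [hg, hq]
    exact Over.w p
  have hc : G.hom.appLE c.V c.W c.leW ≫ g = CommRingCat.ofHom (algebraMap c.R C) := by
    apply Spec.map_injective
    rw [← cancel_mono c.affV.fromSpec, ← hw, Spec.map_comp, Category.assoc,
      Category.assoc, IsAffineOpen.SpecMap_appLE_fromSpec _ c.affV c.affW c.leW]
  refine ⟨{ g.hom with commutes' := fun r => ?_ }, ?_⟩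
  · exact DFunLike.congr_fun (congrArg CommRingCat.Hom.hom hc) r
  · ext1
    change Spec.map g ≫ c.affW.fromSpec = _
    rw [hg, hq]

/-- The ring of functions on the product of two copies of the first infinitesimal neighbourhood of
the unit section of `G`. -/
abbrev InfTwo : Type u := InfOne c.counit ⊗[c.R] InfOne c.counit

theorem surjective_comap_counit : Function.Surjective (PrimeSpectrum.comap
    (Algebra.TensorProduct.lift (InfOne.counit c.counit) (InfOne.counit c.counit)
      fun _ _ => Commute.all _ _ : c.InfTwo →ₐ[c.R] c.R).toRingHom) := by
  set f := (Algebra.TensorProduct.lift (InfOne.counit c.counit) (InfOne.counit c.counit)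
      fun _ _ => Commute.all _ _ : c.InfTwo →ₐ[c.R] c.R)
  intro p
  have hs : Function.Surjective f.toRingHom := fun r => ⟨algebraMap _ _ r, f.commutes r⟩
  have hn : ∀ q : InfOne c.counit, (q - algebraMap c.R _ (InfOne.counit c.counit q)) ^ 2 = 0 := by
    intro q
    have := Ideal.pow_mem_pow (InfOne.sub_counit_mem c.counit q) 2
    rwa [Ideal.cotangentIdeal_square] at this
  have h1 : ∀ q : InfOne c.counit, q ⊗ₜ[c.R] (1 : InfOne c.counit) -
      algebraMap c.R _ (InfOne.counit c.counit q) ∈ p.asIdeal := by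
    intro q
    refine p.2.mem_of_pow_mem 2 ?_
    have := congrArg (Algebra.TensorProduct.includeLeft : InfOne c.counit →ₐ[c.R] c.InfTwo) (hn q)
    rw [map_pow, map_sub, AlgHom.commutes, map_zero] at this
    change (q ⊗ₜ[c.R] (1 : InfOne c.counit) - _) ^ 2 ∈ _
    change (q ⊗ₜ[c.R] (1 : InfOne c.counit) - _) ^ 2 = _ at this
    rw [this]
    exact zero_mem _
  have h2 : ∀ q : InfOne c.counit, (1 : InfOne c.counit) ⊗ₜ[c.R] q -
      algebraMap c.R _ (InfOne.counit c.counit q) ∈ p.asIdeal := by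
    intro q
    refine p.2.mem_of_pow_mem 2 ?_
    have := congrArg (Algebra.TensorProduct.includeRight : InfOne c.counit →ₐ[c.R] c.InfTwo) (hn q)
    rw [map_pow, map_sub, AlgHom.commutes, map_zero] at this
    change ((1 : InfOne c.counit) ⊗ₜ[c.R] q - _) ^ 2 ∈ _
    change ((1 : InfOne c.counit) ⊗ₜ[c.R] q - _) ^ 2 = _ at this
    rw [this]
    exact zero_mem _
  have h3 : ∀ t : c.InfTwo, t - algebraMap c.R _ (f t) ∈ p.asIdeal := by
    intro t
    induction t using TensorProduct.induction_on with
    | zero => simp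
    | add t t' h h' =>
      have := add_mem h h'
      rw [map_add, map_add]
      convert this using 1
      ring
    | tmul q q' =>
      have e : q ⊗ₜ[c.R] q' = (q ⊗ₜ[c.R] (1 : InfOne c.counit)) *
          ((1 : InfOne c.counit) ⊗ₜ[c.R] q') := by simp
      have ef : f (q ⊗ₜ[c.R] q') = InfOne.counit c.counit q * InfOne.counit c.counit q' := by
        simp [f]
      rw [ef, e, map_mul]
      have := add_mem (Ideal.mul_mem_left _ (q ⊗ₜ[c.R] (1 : InfOne c.counit)) (h2 q'))
        (Ideal.mul_mem_right (algebraMap c.R _ (InfOne.counit c.counit q')) _ (h1 q))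
      convert this using 1
      ring
  have hk : p ∈ PrimeSpectrum.zeroLocus (RingHom.ker f.toRingHom : Set c.InfTwo) := by
    rw [PrimeSpectrum.mem_zeroLocus]
    intro t ht
    have h4 := h3 t
    have h5 : f t = 0 := ht
    rwa [h5, map_zero, sub_zero] at h4
  rw [← _root_.range_comap_of_surjective _ _ hs] at hk
  exact hk

/-- The first projection from that product, followed by the inclusion in `G`. -/
def inc₁ : c.A →ₐ[c.R] c.InfTwo :=
  Algebra.TensorProduct.includeLeft.comp (Ideal.Quotient.mkₐ c.R _)

/-- The second projection from that product, followed by the inclusion in `G`. -/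
def inc₂ : c.A →ₐ[c.R] c.InfTwo :=
  Algebra.TensorProduct.includeRight.comp (Ideal.Quotient.mkₐ c.R _)

theorem exists_comul : ∃ m : c.A →ₐ[c.R] c.InfTwo, c.pt m = c.pt c.inc₁ * c.pt c.inc₂ := by
  refine c.exists_pt _ (Algebra.TensorProduct.lift (InfOne.counit c.counit)
    (InfOne.counit c.counit) fun _ _ => Commute.all _ _) c.surjective_comap_counit c.counit ?_
  have h : c.pt c.counit = 1 := by
    rw [← c.pt_counit (C := c.R)]
    congr 1
  rw [MonObj.comp_mul, specMap_pt, specMap_pt, h, ← _root_.one_mul (1 : c.spec c.R ⟶ G)]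
  congr 1
  · rw [← h]
    congr 1
    ext a
    simp [inc₁]
  · rw [← h]
    congr 1
    ext a
    simp [inc₂]

/-- The comultiplication given by the group law of `G`: it corresponds to the product in `G` of the
two tautological points (see `pt_comul`). -/
def comul : InfComul c.counit where
  toAlgHom := c.exists_comul.choose
  counit_left := by
    apply c.pt_injective
    rw [← specMap_pt, c.exists_comul.choose_spec, MonObj.comp_mul, specMap_pt, specMap_pt]
    have e1 : (Algebra.TensorProduct.lift ((Algebra.ofId c.R (InfOne c.counit)).comp
        (InfOne.counit c.counit)) (AlgHom.id c.R (InfOne c.counit))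
        fun _ _ => Commute.all _ _).comp c.inc₁ =
        (Algebra.ofId c.R (InfOne c.counit)).comp c.counit := by
      ext a
      simp [inc₁]
    have e2 : (Algebra.TensorProduct.lift ((Algebra.ofId c.R (InfOne c.counit)).comp
        (InfOne.counit c.counit)) (AlgHom.id c.R (InfOne c.counit))
        fun _ _ => Commute.all _ _).comp c.inc₂ = Ideal.Quotient.mkₐ c.R _ := by
      ext a
      simp [inc₂]
    rw [e1, e2, pt_counit, _root_.one_mul]
  counit_right := by
    apply c.pt_injective
    rw [← specMap_pt, c.exists_comul.choose_spec, MonObj.comp_mul, specMap_pt, specMap_pt]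
    have e1 : (Algebra.TensorProduct.lift (AlgHom.id c.R (InfOne c.counit))
        ((Algebra.ofId c.R (InfOne c.counit)).comp (InfOne.counit c.counit))
        fun _ _ => Commute.all _ _).comp c.inc₁ = Ideal.Quotient.mkₐ c.R _ := by
      ext a
      simp [inc₁]
    have e2 : (Algebra.TensorProduct.lift (AlgHom.id c.R (InfOne c.counit))
        ((Algebra.ofId c.R (InfOne c.counit)).comp (InfOne.counit c.counit))
        fun _ _ => Commute.all _ _).comp c.inc₂ =
        (Algebra.ofId c.R (InfOne c.counit)).comp c.counit := by
      ext a
      simp [inc₂]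
    rw [e1, e2, pt_counit, _root_.mul_one]

theorem pt_comul : c.pt c.comul.toAlgHom = c.pt c.inc₁ * c.pt c.inc₂ :=
  c.exists_comul.choose_spec

/-- One chart is contained in another. -/
structure LE (c' c : Chart X G) : Prop where
  V : c'.V ≤ c.V
  U : c'.U ≤ c.U
  W : c'.W ≤ c.W

variable {c} {c' : Chart X G}

/-- Restriction of functions on the base. -/
def resR (h : c'.LE c) : c.R →+* c'.R := (S.presheaf.map (homOfLE h.V).op).hom
/-- Restriction of functions on `X`. -/
def resB (h : c'.LE c) : c.B →+* c'.B := (X.left.presheaf.map (homOfLE h.U).op).hom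
/-- Restriction of functions on `G`. -/
def resA (h : c'.LE c) : c.A →+* c'.A := (G.left.presheaf.map (homOfLE h.W).op).hom

theorem resB_algebraMap (h : c'.LE c) :
    (resB h).comp (algebraMap c.R c.B) = (algebraMap c'.R c'.B).comp (resR h) := by
  have h1 : X.hom.appLE c.V c.U c.leU ≫ X.left.presheaf.map (homOfLE h.U).op =
      S.presheaf.map (homOfLE h.V).op ≫ X.hom.appLE c'.V c'.U c'.leU := by
    rw [Scheme.Hom.appLE_map, Scheme.Hom.map_appLE]
  exact congrArg CommRingCat.Hom.hom h1

theorem counit_resA (h : c'.LE c) (a : c.A) : c'.counit (resA h a) = resR h (c.counit a) := by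
  have h1 : (unitSection G).appLE c.W c.V c.unit_le ≫ S.presheaf.map (homOfLE h.V).op =
      G.left.presheaf.map (homOfLE h.W).op ≫ (unitSection G).appLE c'.W c'.V c'.unit_le := by
    rw [Scheme.Hom.appLE_map, Scheme.Hom.map_appLE]
  exact (DFunLike.congr_fun (congrArg CommRingCat.Hom.hom h1) a).symm

/-- Restriction of functions that vanish on the unit section. -/
def resI (h : c'.LE c) (z : c.I) : c'.I :=
  ⟨resA h z, by
    have hz : c.counit z = 0 := z.2
    rw [RingHom.mem_ker, counit_resA, hz, map_zero]⟩

end Chart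

variable (X G) in
/-- A family of linear maps `ω_{G/S} → p_* Ωⁿ_{X/S}`, one on each chart (`p : X → S`). -/
abbrev FormFamily (n : ℕ) : Type _ := ∀ c : Chart X G, c.coLie →ₗ[c.R] KForm c.R c.B n

/-- The family is compatible with restriction, so that it is a global `𝒪_S`-linear map
`ω_{G/S} → p_* Ωⁿ_{X/S}`; for smooth `G` this is a `Lie(G)`-valued `n`-form on `X`. -/
def FormFamily.IsGlobal {n : ℕ} (φ : FormFamily X G n) : Prop :=
  ∀ (c c' : Chart X G) (h : c'.LE c) (z : c.I),
    φ c' (c'.I.toCotangent (Chart.resI h z)) =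
      KForm.map (Chart.resR h) (Chart.resB h) (Chart.resB_algebraMap h) n
        (φ c (c.I.toCotangent z))

/-- The exterior derivative of a `Lie(G)`-valued `1`-form, `d(Y ⊗ η) = Y ⊗ dη`
(see `dForm_comp_dualTensorHom`). -/
def FormFamily.d (φ : FormFamily X G 1) : FormFamily X G 2 := fun c =>
  (dForm c.R c.B).comp (φ c)

/-- The `2`-form `[φ]^{(2)}` of a `Lie(G)`-valued `1`-form `φ`. -/
def FormFamily.sq (φ : FormFamily X G 1) : FormFamily X G 2 := fun c =>
  sqForm c.comul (φ c)

theorem IsInfSimplex.appLE_base {T : Over S} {n : ℕ} {x : Fin (n + 1) → (T ⟶ X)}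
    (c : Chart X G) (T' : T.left.Opens)
    (hT : ∀ i, T' ≤ (x i).left ⁻¹ᵁ c.U) (i : Fin (n + 1)) (r : c.R) :
    ((x i).left.appLE c.U T' (hT i)).hom (algebraMap c.R c.B r) =
      ((x 0).left.appLE c.U T' (hT 0)).hom (algebraMap c.R c.B r) := by
  change ((x i).left.appLE c.U T' (hT i)).hom ((X.hom.appLE c.V c.U c.leU).hom r) =
    ((x 0).left.appLE c.U T' (hT 0)).hom ((X.hom.appLE c.V c.U c.leU).hom r)
  rw [← CommRingCat.comp_apply, ← CommRingCat.comp_apply, Scheme.Hom.appLE_comp_appLE,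
    Scheme.Hom.appLE_comp_appLE]
  have h : ∀ (f g : T.left ⟶ S) (_ : f = g) (hf : T' ≤ f ⁻¹ᵁ c.V) (hg : T' ≤ g ⁻¹ᵁ c.V),
      f.appLE c.V T' hf = g.appLE c.V T' hg := by
    rintro f _ rfl hf hg
    rfl
  rw [h _ _ ((Over.w (x i)).trans (Over.w (x 0)).symm)]

/-- The morphism `f : Δⁿ_{X/S} → G` is the combinatorial form that corresponds to the classical
`Lie(G)`-valued form `φ`: for each function `z` on `G` that vanishes on the unit section, `z ∘ f`
is the function `φ(z)` on `Δⁿ_{X/S}`, a differential form being a function by `evalForm`. -/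
def Represents {n : ℕ} (f : CombFun X G n) (φ : FormFamily X G n) : Prop :=
  ∀ {T : Over S} (x : Fin (n + 1) → (T ⟶ X)) (hx : IsInfSimplex x) (c : Chart X G)
    (T' : T.left.Opens) (hT : ∀ i, T' ≤ (x i).left ⁻¹ᵁ c.U),
    ∃ hW : T' ≤ (f.val x hx).left ⁻¹ᵁ c.W, ∀ z : c.I,
      ((f.val x hx).left.appLE c.W T' hW).hom z =
        evalForm (hx.close c.U c.affU T' hT) (IsInfSimplex.appLE_base c T' hT)
          (φ c (c.I.toCotangent z))

end Geometry
end CombForms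

end

open CombForms CategoryTheory AlgebraicGeometry

/-!
# Cartan's structural equation for combinatorial forms

The ring of functions on `Δ¹` over an affine piece `Spec B` of `X` is `B ⊗ B / J² = B ⊕ Ω`, and on
`Δ²` it is `B ⊕ Ω ε₁ ⊕ Ω ε₂ ⊕ Ω² ε₁ε₂`. Hence a form of degree `1` or `2` is determined by its values
on infinitesimal simplices (`evalAlg_pairVertex_injective`, `evalAlg_vertex_injective`), which gives
uniqueness and globality of the classical form that corresponds to a combinatorial function
(`Represents.unique`, `Represents.isGlobal`).

A combinatorial `1`-form is trivial on the diagonal of `Δ¹`, so on functions it maps the ideal `I` of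
the unit section to the square-zero ideal `Ω`: it is a linear map `I/I² → Ω`
(`CombFun.IsForm.exists_represents`). Conversely a linear map `I/I² → Ω` defines points of `G` on the
simplices of each chart. Points that come from two charts agree, since they agree on a chart contained
in both, and therefore they glue (`existsUnique_value`, `FormFamily.IsGlobal.exists_represents`).

All products of points take place in the first infinitesimal neighbourhood of the unit section, where
the group law is `z ↦ z ⊗ 1 + 1 ⊗ z + ∑ αᵢ ⊗ βᵢ`. It yields `ω(x, y) ω(y, x) = 1`
(`Represents.val_mul_val_swap`), and `δ¹ω = θ` becomes `ω(x₀, x₁) ω(x₁, x₂) = θ ω(x₀, x₂)`, an equation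
between products of two factors. There `θ = dω + [ω]^{(2)}` solves it, because the coboundary of a
`1`-form is `dω` (`evalAlg_dForm`) and the cross terms `∑ φ(αᵢ)(x₀, x₁) φ(βᵢ)(x₁, x₂)` are the value
of `∑ φ(αᵢ) ∧ φ(βᵢ)` (`evalAlg_wedgeOne`); see `mulInf_triangle` and `Represents.deltaOne`.

Smoothness of `G` serves to make `I/I²` finite projective, so that `Lie(G) ⊗ Ωⁿ` is the module of
linear maps from `I/I²` to `Ωⁿ` (`dualTensorHom_coLie_bijective`).
-/

noncomputable section

namespace CombForms

/-! ### Differential forms as functions on infinitesimal simplices -/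

section Algebra

variable {R B : Type u} [CommRing R] [CommRing B] [Algebra R B] {C : Type u} [CommRing C]

/-- Additive maps on `Ωⁿ` that agree on the elements `c db₁ ∧ ... ∧ dbₙ` are equal. -/
theorem KForm.addHom_ext {M : Type*} [AddCommGroup M] {n : ℕ} {f g : KForm R B n →+ M}
    (h : ∀ (c : B) (b : Fin n → B),
      f (c • exteriorPower.ιMulti B n fun i => KaehlerDifferential.D R B (b i)) =
        g (c • exteriorPower.ιMulti B n fun i => KaehlerDifferential.D R B (b i))) : f = g := by
  have hs := exteriorPower.ιMulti_span_of_span (R := B) (M := Ω[B⁄R]) (n := n)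
    (KaehlerDifferential.span_range_derivation R B)
  have key : ∀ η : KForm R B n, ∀ c : B, f (c • η) = g (c • η) := by
    intro η
    have hη : η ∈ (⊤ : Submodule B (KForm R B n)) := trivial
    rw [← hs] at hη
    induction hη using Submodule.span_induction with
    | zero => simp
    | add x y _ _ hx hy => intro c; rw [smul_add, map_add, map_add, hx, hy]
    | smul a x _ hx => intro c; rw [smul_smul, hx]
    | mem x hx =>
      obtain ⟨v, hv, rfl⟩ := hx
      intro c
      choose b hb using fun i => hv ⟨i, rfl⟩
      obtain rfl : (fun i => KaehlerDifferential.D R B (b i)) = v := funext hb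
      exact h c b
  ext η
  simpa using key η 1

theorem IsInfClose.comp {D : Type u} [CommRing D] {n : ℕ} {x : Fin (n + 1) → B →+* C}
    (hx : IsInfClose x) (g : C →+* D) : IsInfClose fun i => g.comp (x i) where
  sq i j b b' := by
    simp only [RingHom.comp_apply, ← map_sub, ← map_mul, hx.sq, map_zero]
  strong i j b := by
    simp only [RingHom.comp_apply, ← map_sub, ← map_mul, hx.strong, map_zero]

theorem IsInfClose.precomp {B' : Type u} [CommRing B'] {n : ℕ} {x : Fin (n + 1) → B →+* C}
    (hx : IsInfClose x) (g : B' →+* B) : IsInfClose fun i => (x i).comp g where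
  sq i j _ _ := hx.sq i j _ _
  strong i j _ := hx.strong i j _

theorem IsInfClose.reindex {n m : ℕ} {x : Fin (n + 1) → B →+* C}
    (hx : IsInfClose x) (σ : Fin (m + 1) → Fin (n + 1)) : IsInfClose fun i => x (σ i) where
  sq _ _ _ _ := hx.sq _ _ _ _
  strong i j b := by
    linear_combination hx.strong (σ i) (σ j) b - hx.strong (σ i) (σ 0) b -
      hx.strong (σ 0) (σ j) b + hx.strong (σ 0) (σ 0) b

/-- The polarization of `IsInfClose.strong`. -/
theorem IsInfClose.strong₂ {n : ℕ} {x : Fin (n + 1) → B →+* C} (hx : IsInfClose x)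
    (i j : Fin (n + 1)) (b b' : B) :
    (x i b - x 0 b) * (x j b' - x 0 b') + (x i b' - x 0 b') * (x j b - x 0 b) = 0 := by
  have h := hx.strong i j (b + b')
  simp only [map_add] at h
  linear_combination h - hx.strong i j b - hx.strong i j b'

/-- `evalForm` is natural in the ring in which the simplex takes its values. -/
theorem evalForm_comp {D : Type u} [CommRing D] {n : ℕ} {x : Fin (n + 1) → B →+* C}
    (hx : IsInfClose x) (hR : ∀ i r, x i (algebraMap R B r) = x 0 (algebraMap R B r))
    {y : Fin (n + 1) → B →+* D} (hy : IsInfClose y)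
    (hR' : ∀ i r, y i (algebraMap R B r) = y 0 (algebraMap R B r)) (g : C →+* D)
    (hg : ∀ i b, y i b = g (x i b)) (η : KForm R B n) :
    evalForm hy hR' η = g (evalForm hx hR η) := by
  suffices h : evalForm hy hR' = (g : C →+ D).comp (evalForm hx hR) from DFunLike.congr_fun h η
  refine KForm.addHom_ext fun c b => ?_
  rw [AddMonoidHom.comp_apply, evalForm_smul_ιMulti, evalForm_smul_ιMulti]
  simp [hg]

/-- `evalForm` is natural in the ring on which the form lives. -/
theorem evalForm_map {R' B' : Type u} [CommRing R'] [CommRing B'] [Algebra R' B'] {n : ℕ}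
    {x : Fin (n + 1) → B →+* C}
    (hx : IsInfClose x) (hR : ∀ i r, x i (algebraMap R B r) = x 0 (algebraMap R B r))
    {y : Fin (n + 1) → B' →+* C} (hy : IsInfClose y)
    (hR' : ∀ i r, y i (algebraMap R' B' r) = y 0 (algebraMap R' B' r))
    (ρ : R →+* R') (β : B →+* B') (h : β.comp (algebraMap R B) = (algebraMap R' B').comp ρ)
    (hxy : ∀ i b, y i (β b) = x i b) (η : KForm R B n) :
    evalForm hy hR' (KForm.map ρ β h n η) = evalForm hx hR η := by
  suffices h : (evalForm hy hR').comp (KForm.map ρ β h n) = evalForm hx hR from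
    DFunLike.congr_fun h η
  refine KForm.addHom_ext fun c b => ?_
  rw [AddMonoidHom.comp_apply, KForm.map_smul_ιMulti, evalForm_smul_ιMulti, evalForm_smul_ιMulti]
  simp [hxy]

theorem evalForm_smul {n : ℕ} {x : Fin (n + 1) → B →+* C}
    (hx : IsInfClose x) (hR : ∀ i r, x i (algebraMap R B r) = x 0 (algebraMap R B r))
    (a : B) (η : KForm R B n) : evalForm hx hR (a • η) = x 0 a * evalForm hx hR η := by
  suffices h : (evalForm hx hR).comp (DistribSMul.toAddMonoidHom (KForm R B n) a) =
      (AddMonoidHom.mulLeft (x 0 a)).comp (evalForm hx hR) from DFunLike.congr_fun h η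
  refine KForm.addHom_ext fun c b => ?_
  simp only [AddMonoidHom.comp_apply, DistribSMul.toAddMonoidHom_apply, smul_smul,
    evalForm_smul_ιMulti, AddMonoidHom.coe_mulLeft, map_mul, mul_assoc]

/-- The value of a form is a sum of multiples of elements `xₖ b - x₀ b`, for each `k ≥ 1`. -/
theorem evalForm_mul_eq_zero {n : ℕ} {x : Fin (n + 1) → B →+* C}
    (hx : IsInfClose x) (hR : ∀ i r, x i (algebraMap R B r) = x 0 (algebraMap R B r))
    (η : KForm R B n) (k : Fin n) {y : C} (hy : ∀ b : B, (x k.succ b - x 0 b) * y = 0) :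
    evalForm hx hR η * y = 0 := by
  suffices h : (AddMonoidHom.mulRight y).comp (evalForm hx hR) = 0 from DFunLike.congr_fun h η
  refine KForm.addHom_ext fun c b => ?_
  rw [AddMonoidHom.comp_apply, evalForm_smul_ιMulti, ← Finset.mul_prod_erase _ _ (Finset.mem_univ k)]
  simp only [AddMonoidHom.coe_mulRight, AddMonoidHom.zero_apply]
  linear_combination
    (x 0 c * ∏ i ∈ Finset.univ.erase k, (x i.succ (b i) - x 0 (b i))) * hy (b k)

end Algebra

section Algebra

variable {R B : Type u} [CommRing R] [CommRing B] [Algebra R B] {C : Type u} [CommRing C]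
  [Algebra R C]

/-- The function `evalForm` on forms, as an `R`-linear map, for a simplex whose vertices are maps of
`R`-algebras. -/
def evalAlg {n : ℕ} (ξ : Fin (n + 1) → B →ₐ[R] C) (h : IsInfClose fun i => (ξ i).toRingHom) :
    KForm R B n →ₗ[R] C :=
  { evalForm h (R := R) fun i r => ((ξ i).commutes r).trans ((ξ 0).commutes r).symm with
    map_smul' := fun r η => by
      change evalForm _ _ (r • η) = r • evalForm _ _ η
      rw [← algebraMap_smul B r η, evalForm_smul, Algebra.smul_def]
      congr 1
      exact (ξ 0).commutes r }

theorem evalAlg_smul_ιMulti {n : ℕ} (ξ : Fin (n + 1) → B →ₐ[R] C)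
    (h : IsInfClose fun i => (ξ i).toRingHom) (c : B) (b : Fin n → B) :
    evalAlg ξ h (c • exteriorPower.ιMulti B n fun i => KaehlerDifferential.D R B (b i)) =
      ξ 0 c * ∏ i : Fin n, (ξ i.succ (b i) - ξ 0 (b i)) :=
  evalForm_smul_ιMulti h _ c b

theorem KForm.linearMap_ext {M : Type*} [AddCommGroup M] [Module R M] {n : ℕ}
    {f g : KForm R B n →ₗ[R] M}
    (h : ∀ (c : B) (b : Fin n → B),
      f (c • exteriorPower.ιMulti B n fun i => KaehlerDifferential.D R B (b i)) =
        g (c • exteriorPower.ιMulti B n fun i => KaehlerDifferential.D R B (b i))) : f = g :=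
  LinearMap.toAddMonoidHom_injective (KForm.addHom_ext h)

theorem evalAlg_comp {D : Type u} [CommRing D] [Algebra R D] {n : ℕ}
    (ξ : Fin (n + 1) → B →ₐ[R] C) (h : IsInfClose fun i => (ξ i).toRingHom) (g : C →ₐ[R] D)
    (h' : IsInfClose fun i => (g.comp (ξ i)).toRingHom) (η : KForm R B n) :
    evalAlg (fun i => g.comp (ξ i)) h' η = g (evalAlg ξ h η) :=
  evalForm_comp h _ h' _ g.toRingHom (fun _ _ => rfl) η

theorem evalAlg_mul_eq_zero {n : ℕ} (ξ : Fin (n + 1) → B →ₐ[R] C)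
    (h : IsInfClose fun i => (ξ i).toRingHom) (η : KForm R B n) (k : Fin n) {y : C}
    (hy : ∀ b : B, (ξ k.succ b - ξ 0 b) * y = 0) : evalAlg ξ h η * y = 0 :=
  evalForm_mul_eq_zero h _ η k hy

theorem evalAlg_mul_evalAlg {n : ℕ} (ξ : Fin (n + 2) → B →ₐ[R] C)
    (h : IsInfClose fun i => (ξ i).toRingHom) (η θ : KForm R B (n + 1)) :
    evalAlg ξ h η * evalAlg ξ h θ = 0 := by
  refine evalAlg_mul_eq_zero ξ h η 0 fun b => ?_
  rw [mul_comm]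
  refine evalAlg_mul_eq_zero ξ h θ 0 fun b' => ?_
  exact h.sq 1 0 b' b

theorem evalAlg_eq_zero_of_eq (ξ : Fin 2 → B →ₐ[R] C)
    (h : IsInfClose fun i => (ξ i).toRingHom) (h01 : ξ 0 = ξ 1) : evalAlg ξ h = 0 := by
  refine KForm.linearMap_ext fun c b => ?_
  rw [evalAlg_smul_ιMulti]
  simp [h01]

theorem IsInfClose.pair {n : ℕ} {ξ : Fin (n + 1) → B →ₐ[R] C}
    (h : IsInfClose fun i => (ξ i).toRingHom) (i j : Fin (n + 1)) :
    IsInfClose fun k => ((![ξ i, ξ j] : Fin 2 → B →ₐ[R] C) k).toRingHom := by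
  have := h.reindex ![i, j]
  convert this using 1
  funext k
  fin_cases k <;> rfl

/-- A `1`-form changes sign when the two ends of an edge are exchanged. -/
theorem evalAlg_swap {n : ℕ} {ξ : Fin (n + 1) → B →ₐ[R] C}
    (h : IsInfClose fun i => (ξ i).toRingHom) (i j : Fin (n + 1)) (η : KForm R B 1) :
    evalAlg ![ξ i, ξ j] (h.pair i j) η = -evalAlg ![ξ j, ξ i] (h.pair j i) η := by
  suffices H : evalAlg ![ξ i, ξ j] (h.pair i j) = -evalAlg ![ξ j, ξ i] (h.pair j i) from
    DFunLike.congr_fun H η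
  refine KForm.linearMap_ext fun c b => ?_
  rw [LinearMap.neg_apply, evalAlg_smul_ιMulti, evalAlg_smul_ιMulti]
  have := h.sq i j c (b 0)
  simp only [AlgHom.toRingHom_eq_coe, RingHom.coe_coe] at this
  simp
  linear_combination -this

theorem oneEquiv_smul_ιMulti (c : B) (b : Fin 1 → B) :
    exteriorPower.oneEquiv B Ω[B⁄R]
      (c • exteriorPower.ιMulti B 1 fun i => KaehlerDifferential.D R B (b i)) =
    c • KaehlerDifferential.D R B (b 0) := by
  rw [map_smul, exteriorPower.oneEquiv_ιMulti]

theorem wedge_D (a b : B) : wedge R B (KaehlerDifferential.D R B a) (KaehlerDifferential.D R B b) =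
    (1 : B) • exteriorPower.ιMulti B 2
      fun i => KaehlerDifferential.D R B ((![a, b] : Fin 2 → B) i) := by
  rw [one_smul]
  change exteriorPower.ιMulti B 2 _ = _
  congr 1
  funext i
  fin_cases i <;> rfl

/-- The coboundary of a `1`-form, as a function on infinitesimal triangles, is its exterior
derivative. -/
theorem evalAlg_dForm (ξ : Fin 3 → B →ₐ[R] C)
    (h : IsInfClose fun i => (ξ i).toRingHom) (η : KForm R B 1) :
    evalAlg ξ h (dForm R B η) = evalAlg ![ξ 0, ξ 1] (h.pair 0 1) η +
      evalAlg ![ξ 1, ξ 2] (h.pair 1 2) η - evalAlg ![ξ 0, ξ 2] (h.pair 0 2) η := by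
  suffices H : (evalAlg ξ h).comp (dForm R B) = evalAlg ![ξ 0, ξ 1] (h.pair 0 1) +
      evalAlg ![ξ 1, ξ 2] (h.pair 1 2) - evalAlg ![ξ 0, ξ 2] (h.pair 0 2) from
    DFunLike.congr_fun H η
  refine KForm.linearMap_ext fun c b => ?_
  have e : dForm R B (c • exteriorPower.ιMulti B 1 fun i => KaehlerDifferential.D R B (b i)) =
      wedge R B (KaehlerDifferential.D R B c) (KaehlerDifferential.D R B (b 0)) := by
    change dOne R B (exteriorPower.oneEquiv B Ω[B⁄R] _) = _
    rw [oneEquiv_smul_ιMulti, dOne_smul_D]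
  rw [LinearMap.comp_apply, e, wedge_D, LinearMap.sub_apply, LinearMap.add_apply,
    evalAlg_smul_ιMulti, evalAlg_smul_ιMulti, evalAlg_smul_ιMulti, evalAlg_smul_ιMulti]
  have := h.sq 1 0 c (b 0)
  simp only [AlgHom.toRingHom_eq_coe, RingHom.coe_coe] at this
  simp [Fin.prod_univ_two]
  linear_combination this

/-- The cup product of `1`-forms, as a function on infinitesimal triangles, is their exterior
product. -/
theorem evalAlg_wedgeOne (ξ : Fin 3 → B →ₐ[R] C)
    (h : IsInfClose fun i => (ξ i).toRingHom) (η θ : KForm R B 1) :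
    evalAlg ξ h (wedgeOne R B η θ) = evalAlg ![ξ 0, ξ 1] (h.pair 0 1) η *
      evalAlg ![ξ 1, ξ 2] (h.pair 1 2) θ := by
  suffices H : (wedgeOne R B).compr₂ (evalAlg ξ h) =
      (LinearMap.mul R C).compl₁₂ (evalAlg ![ξ 0, ξ 1] (h.pair 0 1))
        (evalAlg ![ξ 1, ξ 2] (h.pair 1 2)) from
    DFunLike.congr_fun (DFunLike.congr_fun H η) θ
  refine KForm.linearMap_ext fun c b => KForm.linearMap_ext fun c' b' => ?_
  have e : wedgeOne R B
      (c • exteriorPower.ιMulti B 1 fun i => KaehlerDifferential.D R B (b i))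
      (c' • exteriorPower.ιMulti B 1 fun i => KaehlerDifferential.D R B (b' i)) =
      (c * c') • wedge R B (KaehlerDifferential.D R B (b 0)) (KaehlerDifferential.D R B (b' 0)) := by
    change wedge R B (exteriorPower.oneEquiv B Ω[B⁄R] _) (exteriorPower.oneEquiv B Ω[B⁄R] _) = _
    rw [oneEquiv_smul_ιMulti, oneEquiv_smul_ιMulti, wedge_smul_left, wedge_smul_right, smul_smul]
  rw [LinearMap.compr₂_apply, LinearMap.compl₁₂_apply, LinearMap.mul_apply', e, wedge_D, smul_smul,
    evalAlg_smul_ιMulti, evalAlg_smul_ιMulti, evalAlg_smul_ιMulti]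
  have h1 := h.sq 1 0 (b 0) c'
  have h2 := h.sq 1 0 (b 0) (b' 0)
  simp only [AlgHom.toRingHom_eq_coe, RingHom.coe_coe] at h1 h2
  simp [Fin.prod_univ_two]
  linear_combination (-ξ 0 c * (ξ 2 (b' 0) - ξ 1 (b' 0))) * h1 + ξ 0 c * ξ 0 c' * h2

/-! ### The ring of functions on pairs of infinitesimally close points -/

section Universal

variable (R B)

/-- The ring of functions on `Δ¹`. -/
abbrev PairRing : Type u := B ⊗[R] B ⧸ KaehlerDifferential.ideal R B ^ 2

/-- The two tautological points with values in the functions on `Δ¹`. -/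
def pairVertex : Fin 2 → B →ₐ[R] PairRing R B :=
  ![(Ideal.Quotient.mkₐ R _).comp Algebra.TensorProduct.includeLeft,
    (Ideal.Quotient.mkₐ R _).comp Algebra.TensorProduct.includeRight]

theorem isInfClose_pair {ξ : Fin 2 → B →ₐ[R] C}
    (h : ∀ b b', (ξ 1 b - ξ 0 b) * (ξ 1 b' - ξ 0 b') = 0) :
    IsInfClose fun i => (ξ i).toRingHom := by
  constructor
  · intro i j b b'
    have := h b b'
    fin_cases i <;> fin_cases j <;> simp
    · linear_combination this
    · exact this
  · intro i j b
    have := h b b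
    fin_cases i <;> fin_cases j <;> simp
    · simpa using this

theorem isInfClose_pairVertex : IsInfClose fun i => (pairVertex R B i).toRingHom := by
  refine isInfClose_pair R B fun b b' => ?_
  change Ideal.Quotient.mk _ (((1 : B) ⊗ₜ[R] b - b ⊗ₜ[R] (1 : B)) *
    ((1 : B) ⊗ₜ[R] b' - b' ⊗ₜ[R] (1 : B))) = 0
  rw [Ideal.Quotient.eq_zero_iff_mem, pow_two]
  exact Ideal.mul_mem_mul (KaehlerDifferential.one_smul_sub_smul_one_mem_ideal R b)
    (KaehlerDifferential.one_smul_sub_smul_one_mem_ideal R b')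

/-- On the tautological pair of points, a `1`-form takes itself as its value, as an element of the
ideal `Ω = J/J²` of `B ⊗ B / J²`. -/
theorem evalAlg_pairVertex (η : KForm R B 1) :
    evalAlg (pairVertex R B) (isInfClose_pairVertex R B) η =
      (KaehlerDifferential.ideal R B).cotangentToQuotientSquare
        (exteriorPower.oneEquiv B Ω[B⁄R] η) := by
  suffices H : (evalAlg (pairVertex R B) (isInfClose_pairVertex R B)).toAddMonoidHom =
      (KaehlerDifferential.ideal R B).cotangentToQuotientSquare.toAddMonoidHom.comp
        (exteriorPower.oneEquiv B Ω[B⁄R]).toLinearMap.toAddMonoidHom from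
    DFunLike.congr_fun H η
  refine KForm.addHom_ext fun c b => ?_
  change evalAlg _ _ _ = (KaehlerDifferential.ideal R B).cotangentToQuotientSquare
    (exteriorPower.oneEquiv B Ω[B⁄R] _)
  rw [evalAlg_smul_ιMulti, oneEquiv_smul_ιMulti]
  have : c • KaehlerDifferential.D R B (b 0) = (KaehlerDifferential.ideal R B).toCotangent
      (c • ⟨(1 : B) ⊗ₜ[R] (b 0) - (b 0) ⊗ₜ[R] (1 : B),
        KaehlerDifferential.one_smul_sub_smul_one_mem_ideal R (b 0)⟩) := by
    rfl
  rw [this, Ideal.toCotangent_to_quotient_square]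
  change _ = Ideal.Quotient.mk _ (c • ((1 : B) ⊗ₜ[R] (b 0) - (b 0) ⊗ₜ[R] (1 : B)))
  rw [Algebra.smul_def, map_mul, map_sub, Fin.prod_univ_one]
  rfl

theorem evalAlg_pairVertex_injective :
    Function.Injective (evalAlg (pairVertex R B) (isInfClose_pairVertex R B)) := by
  intro η θ h
  rw [evalAlg_pairVertex, evalAlg_pairVertex] at h
  exact (exteriorPower.oneEquiv B Ω[B⁄R]).injective
    ((KaehlerDifferential.ideal R B).cotangentToQuotientSquare_injective h)

variable {R B}

/-- The map out of the functions on `Δ¹` given by a pair of infinitesimally close points. -/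
def pairLift (ξ : Fin 2 → B →ₐ[R] C) (h : IsInfClose fun i => (ξ i).toRingHom) :
    PairRing R B →ₐ[R] C :=
  Ideal.Quotient.liftₐ _ (Algebra.TensorProduct.productMap (ξ 0) (ξ 1)) fun a ha => by
    have hle : KaehlerDifferential.ideal R B ^ 2 ≤
        RingHom.ker (Algebra.TensorProduct.productMap (ξ 0) (ξ 1)) := by
      rw [← KaehlerDifferential.span_range_eq_ideal, pow_two, Ideal.span_mul_span', Ideal.span_le]
      rintro _ ⟨_, ⟨b, rfl⟩, _, ⟨b', rfl⟩, rfl⟩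
      have := h.sq 1 0 b b'
      simpa [RingHom.mem_ker] using this
    exact hle ha

theorem pairLift_pairVertex (ξ : Fin 2 → B →ₐ[R] C) (h : IsInfClose fun i => (ξ i).toRingHom)
    (i : Fin 2) : (pairLift ξ h).comp (pairVertex R B i) = ξ i := by
  ext b
  fin_cases i
  · change Algebra.TensorProduct.productMap (ξ 0) (ξ 1) (b ⊗ₜ 1) = ξ 0 b
    simp
  · change Algebra.TensorProduct.productMap (ξ 0) (ξ 1) (1 ⊗ₜ b) = ξ 1 b
    simp

end Universal

end Algebra

/-! ### The ring of functions on infinitesimal triangles -/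

section Triangle

variable (R B : Type u) [CommRing R] [CommRing B] [Algebra R B]

/-- The ring of functions on `Δ²`, that is `B ⊕ Ω ε₁ ⊕ Ω ε₂ ⊕ Ω² ε₁ε₂`, where `ε₁² = ε₂² = 0` and
`(η ε₁) (θ ε₂) = (η ∧ θ) ε₁ε₂`. -/
@[ext]
structure TriangleRing : Type u where
  c₀ : B
  c₁ : Ω[B⁄R]
  c₂ : Ω[B⁄R]
  c₁₂ : KForm R B 2

namespace TriangleRing

variable {R B}

instance : Zero (TriangleRing R B) := ⟨⟨0, 0, 0, 0⟩⟩
instance : One (TriangleRing R B) := ⟨⟨1, 0, 0, 0⟩⟩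
instance : Add (TriangleRing R B) :=
  ⟨fun x y => ⟨x.c₀ + y.c₀, x.c₁ + y.c₁, x.c₂ + y.c₂, x.c₁₂ + y.c₁₂⟩⟩
instance : Neg (TriangleRing R B) := ⟨fun x => ⟨-x.c₀, -x.c₁, -x.c₂, -x.c₁₂⟩⟩
instance : Mul (TriangleRing R B) :=
  ⟨fun x y => ⟨x.c₀ * y.c₀, x.c₀ • y.c₁ + y.c₀ • x.c₁, x.c₀ • y.c₂ + y.c₀ • x.c₂,
    x.c₀ • y.c₁₂ + y.c₀ • x.c₁₂ + wedge R B x.c₁ y.c₂ + wedge R B y.c₁ x.c₂⟩⟩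

@[simp] theorem zero_c₀ : (0 : TriangleRing R B).c₀ = 0 := rfl
@[simp] theorem zero_c₁ : (0 : TriangleRing R B).c₁ = 0 := rfl
@[simp] theorem zero_c₂ : (0 : TriangleRing R B).c₂ = 0 := rfl
@[simp] theorem zero_c₁₂ : (0 : TriangleRing R B).c₁₂ = 0 := rfl
@[simp] theorem one_c₀ : (1 : TriangleRing R B).c₀ = 1 := rfl
@[simp] theorem one_c₁ : (1 : TriangleRing R B).c₁ = 0 := rfl
@[simp] theorem one_c₂ : (1 : TriangleRing R B).c₂ = 0 := rfl
@[simp] theorem one_c₁₂ : (1 : TriangleRing R B).c₁₂ = 0 := rfl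

variable (x y : TriangleRing R B)

@[simp] theorem add_c₀ : (x + y).c₀ = x.c₀ + y.c₀ := rfl
@[simp] theorem add_c₁ : (x + y).c₁ = x.c₁ + y.c₁ := rfl
@[simp] theorem add_c₂ : (x + y).c₂ = x.c₂ + y.c₂ := rfl
@[simp] theorem add_c₁₂ : (x + y).c₁₂ = x.c₁₂ + y.c₁₂ := rfl
@[simp] theorem neg_c₀ : (-x).c₀ = -x.c₀ := rfl
@[simp] theorem neg_c₁ : (-x).c₁ = -x.c₁ := rfl
@[simp] theorem neg_c₂ : (-x).c₂ = -x.c₂ := rfl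
@[simp] theorem neg_c₁₂ : (-x).c₁₂ = -x.c₁₂ := rfl
@[simp] theorem mul_c₀ : (x * y).c₀ = x.c₀ * y.c₀ := rfl
@[simp] theorem mul_c₁ : (x * y).c₁ = x.c₀ • y.c₁ + y.c₀ • x.c₁ := rfl
@[simp] theorem mul_c₂ : (x * y).c₂ = x.c₀ • y.c₂ + y.c₀ • x.c₂ := rfl
@[simp] theorem mul_c₁₂ : (x * y).c₁₂ =
    x.c₀ • y.c₁₂ + y.c₀ • x.c₁₂ + wedge R B x.c₁ y.c₂ + wedge R B y.c₁ x.c₂ := rfl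

instance : CommRing (TriangleRing R B) where
  add_assoc x y z := by ext1 <;> simp [add_assoc]
  zero_add x := by ext1 <;> simp
  add_zero x := by ext1 <;> simp
  add_comm x y := by ext1 <;> simp [add_comm]
  neg_add_cancel x := by ext1 <;> simp
  nsmul := nsmulRec
  zsmul := zsmulRec
  zero_mul x := by ext1 <;> simp
  mul_zero x := by ext1 <;> simp
  one_mul x := by ext1 <;> simp
  mul_one x := by ext1 <;> simp
  mul_comm x y := by
    ext1 <;> simp [mul_comm] <;> abel
  left_distrib x y z := by
    ext1 <;> simp [mul_add, add_smul] <;> abel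
  right_distrib x y z := by
    ext1 <;> simp [add_mul, add_smul] <;> abel
  mul_assoc x y z := by
    ext1
    · simp [mul_assoc]
    · simp [smul_smul]; module
    · simp [smul_smul]; module
    · simp [smul_smul, wedge_smul_left, wedge_smul_right]; module

/-- The inclusion of the functions on `X` by means of the vertex `0`. -/
def inl : B →+* TriangleRing R B where
  toFun b := ⟨b, 0, 0, 0⟩
  map_one' := rfl
  map_zero' := rfl
  map_mul' b b' := by ext1 <;> simp
  map_add' b b' := by ext1 <;> simp

instance : Algebra R (TriangleRing R B) := (inl.comp (algebraMap R B)).toAlgebra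

/-- The three tautological points with values in the functions on `Δ²`: `b`, `b + db ε₁` and
`b + db ε₂`. -/
def vertex : Fin 3 → B →ₐ[R] TriangleRing R B :=
  ![{ inl with commutes' := fun _ => rfl },
    { toFun := fun b => ⟨b, KaehlerDifferential.D R B b, 0, 0⟩
      map_one' := by ext1 <;> simp
      map_zero' := by ext1 <;> simp
      map_mul' := fun b b' => by ext1 <;> simp
      map_add' := fun b b' => by ext1 <;> simp
      commutes' := fun r => by
        ext1
        · rfl
        · exact Derivation.map_algebraMap _ r
        · rfl
        · rfl },
    { toFun := fun b => ⟨b, 0, KaehlerDifferential.D R B b, 0⟩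
      map_one' := by ext1 <;> simp
      map_zero' := by ext1 <;> simp
      map_mul' := fun b b' => by ext1 <;> simp
      map_add' := fun b b' => by ext1 <;> simp
      commutes' := fun r => by
        ext1
        · rfl
        · rfl
        · exact Derivation.map_algebraMap _ r
        · rfl }]

theorem vertex_zero (b : B) : vertex (R := R) 0 b = ⟨b, 0, 0, 0⟩ := rfl
theorem vertex_one (b : B) : vertex (R := R) 1 b = ⟨b, KaehlerDifferential.D R B b, 0, 0⟩ := rfl
theorem vertex_two (b : B) : vertex (R := R) 2 b = ⟨b, 0, KaehlerDifferential.D R B b, 0⟩ := rfl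

theorem isInfClose_vertex : IsInfClose fun i => (vertex (R := R) (B := B) i).toRingHom := by
  have hw := fun b b' : B => wedge_add_swap R B (KaehlerDifferential.D R B b)
    (KaehlerDifferential.D R B b')
  constructor
  · intro i j b b'
    have := hw b b'
    fin_cases i <;> fin_cases j <;>
    · simp only [Fin.zero_eta, Fin.mk_one, Fin.reduceFinMk, AlgHom.toRingHom_eq_coe,
        RingHom.coe_coe, vertex_zero, vertex_one, vertex_two, sub_eq_add_neg]
      ext1 <;> simp
      try first
        | exact this
        | (rw [← neg_add, neg_eq_zero]; exact this)
  · intro i j b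
    have := wedge_self R B (KaehlerDifferential.D R B b)
    fin_cases i <;> fin_cases j <;>
    · simp only [Fin.zero_eta, Fin.mk_one, Fin.reduceFinMk, AlgHom.toRingHom_eq_coe,
        RingHom.coe_coe, vertex_zero, vertex_one, vertex_two, sub_eq_add_neg]
      ext1 <;> simp [this]

/-- The value of a `2`-form on the tautological triangle. -/
theorem evalAlg_vertex (η : KForm R B 2) :
    evalAlg vertex isInfClose_vertex η = (⟨0, 0, 0, η⟩ : TriangleRing R B) := by
  let f : KForm R B 2 →+ TriangleRing R B :=
    { toFun := fun η => ⟨0, 0, 0, η⟩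
      map_zero' := rfl
      map_add' := fun x y => by ext1 <;> simp }
  suffices H : (evalAlg vertex isInfClose_vertex).toAddMonoidHom = f from DFunLike.congr_fun H η
  refine KForm.addHom_ext fun c b => ?_
  change evalAlg _ _ _ = (⟨0, 0, 0, _⟩ : TriangleRing R B)
  have e : (exteriorPower.ιMulti B 2 fun i => KaehlerDifferential.D R B (b i)) =
      wedge R B (KaehlerDifferential.D R B (b 0)) (KaehlerDifferential.D R B (b 1)) := by
    change _ = exteriorPower.ιMulti B 2 _
    congr 1
    funext i
    fin_cases i <;> rfl
  rw [evalAlg_smul_ιMulti, Fin.prod_univ_two, e]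
  change vertex 0 c * ((vertex 1 _ - vertex 0 _) * (vertex 2 _ - vertex 0 _)) = _
  simp only [vertex_zero, vertex_one, vertex_two, sub_eq_add_neg]
  ext1 <;> simp

end TriangleRing

/-- A `2`-form is determined by its values on infinitesimal triangles. -/
theorem evalAlg_vertex_injective :
    Function.Injective (evalAlg (TriangleRing.vertex (R := R) (B := B))
      TriangleRing.isInfClose_vertex) := by
  intro η θ h
  rw [TriangleRing.evalAlg_vertex, TriangleRing.evalAlg_vertex] at h
  exact congrArg TriangleRing.c₁₂ h

end Triangle

/-! ### The conormal module and the points tangent to the unit section -/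

section Hopf

variable {R A : Type u} [CommRing R] [CommRing A] [Algebra R A] (ε : A →ₐ[R] R)

/-- The map `z ↦ 1 ⊗ dz` makes `I/I²` a direct summand of `R ⊗ Ω_{A/R}`, by the Jacobian criterion for
the smooth algebra `R` over itself, as a quotient of the smooth algebra `A`. -/
theorem coLie_finite_projective [Algebra.Smooth R A] :
    Module.Finite R (CoLie ε) ∧ Module.Projective R (CoLie ε) := by
  let _ : Algebra A R := ε.toRingHom.toAlgebra
  have : IsScalarTower R A R := IsScalarTower.of_algebraMap_eq fun r => (ε.commutes r).symm
  have hs : Function.Surjective (algebraMap A R) := fun r => ⟨algebraMap R A r, ε.commutes r⟩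
  obtain ⟨l, hl⟩ := (Algebra.FormallySmooth.iff_split_injection (R := R) hs).1 inferInstance
  let i : CoLie ε →ₗ[R] R ⊗[A] Ω[A⁄R] :=
    { toFun := KaehlerDifferential.kerCotangentToTensor R A R
      map_add' := map_add _
      map_smul' := fun r z => by
        have h1 : r • z = algebraMap R A r • z := (algebraMap_smul A r z).symm
        rw [h1]
        refine (map_smul (KaehlerDifferential.kerCotangentToTensor R A R) _ _).trans ?_
        rw [algebraMap_smul]
        rfl }
  let p : R ⊗[A] Ω[A⁄R] →ₗ[R] CoLie ε :=
    { toFun := l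
      map_add' := map_add _
      map_smul' := fun r z => by
        have h1 : r • z = algebraMap R A r • z := (algebraMap_smul A r z).symm
        rw [h1]
        refine (map_smul l _ _).trans ?_
        exact algebraMap_smul A r _ }
  have hpi : p.comp i = LinearMap.id := LinearMap.ext fun z => DFunLike.congr_fun hl z
  have hp : Function.Surjective p := fun z => ⟨i z, DFunLike.congr_fun hpi z⟩
  exact ⟨Module.Finite.of_surjective p hp, Module.Projective.of_split i p hpi⟩

theorem dualTensorHom_coLie_bijective [Algebra.Smooth R A] (M : Type u) [AddCommGroup M]
    [Module R M] : Function.Bijective (dualTensorHom R (CoLie ε) M) := by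
  obtain ⟨_, _⟩ := coLie_finite_projective ε
  exact dualTensorHom_bijective

variable {ε} {C : Type u} [CommRing C] [Algebra R C]

theorem InfOne.proj_mk_of_mem (z : RingHom.ker ε) :
    InfOne.proj ε (Ideal.Quotient.mk _ (z : A)) = (RingHom.ker ε).toCotangent z := by
  have hz : ε z = 0 := z.2
  rw [InfOne.proj_mk ε _ (by simp [RingHom.mem_ker])]
  congr 1
  ext
  simp [hz]

theorem InfOne.proj_one : InfOne.proj ε 1 = 0 := by
  have := InfOne.proj_mul ε 1 1
  simpa using this

/-- Since `A = R ⊕ I`, an algebra map on `A` is determined by its restriction to `I`. -/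
theorem algHom_ext_of_ker {α β : A →ₐ[R] C} (h : ∀ z : RingHom.ker ε, α z = β z) : α = β := by
  ext a
  have h1 := h ⟨a - algebraMap R A (ε a), by simp [RingHom.mem_ker]⟩
  simpa using h1

/-- The algebra map `A/I² = R ⊕ I/I² → C` given by an `R`-linear map from `I/I²` to an ideal of
square zero of `C`. -/
def infExp (e : CoLie ε →ₗ[R] C) (he : ∀ z z', e z * e z' = 0) : InfOne ε →ₐ[R] C :=
  AlgHom.ofLinearMap ((Algebra.linearMap R C).comp (InfOne.counit ε).toLinearMap +
      e.comp (InfOne.proj ε))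
    (by simp [InfOne.proj_one])
    (fun q q' => by
      have := he (InfOne.proj ε q) (InfOne.proj ε q')
      simp only [LinearMap.add_apply, LinearMap.comp_apply, InfOne.proj_mul, map_mul, map_add,
        map_smul, Algebra.smul_def, Algebra.linearMap_apply, AlgHom.toLinearMap_apply]
      linear_combination -this)

theorem infExp_apply (e : CoLie ε →ₗ[R] C) (he : ∀ z z', e z * e z' = 0) (q : InfOne ε) :
    infExp e he q = algebraMap R C (InfOne.counit ε q) + e (InfOne.proj ε q) := rfl

/-- The `C`-valued point of the group tangent to the unit section given by an `R`-linear map from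
`I/I²` to an ideal of square zero. -/
def ptExp (e : CoLie ε →ₗ[R] C) (he : ∀ z z', e z * e z' = 0) : A →ₐ[R] C :=
  (infExp e he).comp (Ideal.Quotient.mkₐ R _)

theorem ptExp_apply (e : CoLie ε →ₗ[R] C) (he : ∀ z z', e z * e z' = 0) (z : RingHom.ker ε) :
    ptExp e he z = e ((RingHom.ker ε).toCotangent z) := by
  change algebraMap R C (InfOne.counit ε (Ideal.Quotient.mk _ (z : A))) +
    e (InfOne.proj ε (Ideal.Quotient.mk _ (z : A))) = _
  rw [InfOne.proj_mk_of_mem, InfOne.counit_mk, show ε z = 0 from z.2, map_zero, zero_add]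

theorem ptExp_eq_ofId (e : CoLie ε →ₗ[R] C) (he : ∀ z z', e z * e z' = 0) (h0 : e = 0) :
    ptExp e he = (Algebra.ofId R C).comp ε := by
  refine algHom_ext_of_ker (ε := ε) fun z => ?_
  rw [ptExp_apply, h0, AlgHom.comp_apply, show ε z = 0 from z.2, map_zero, LinearMap.zero_apply]

/-- The map `q ⊗ q' ↦ e(q - ε q) e'(q' - ε q')`. -/
def crossTerm (e e' : CoLie ε →ₗ[R] C) : InfOne ε ⊗[R] InfOne ε →ₗ[R] C :=
  TensorProduct.lift ((LinearMap.mul R C).compl₁₂ (e.comp (InfOne.proj ε))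
    (e'.comp (InfOne.proj ε)))

theorem crossTerm_tmul (e e' : CoLie ε →ₗ[R] C) (q q' : InfOne ε) :
    crossTerm e e' (q ⊗ₜ q') = e (InfOne.proj ε q) * e' (InfOne.proj ε q') := rfl

theorem crossTerm_eq_zero (e e' : CoLie ε →ₗ[R] C) (h : ∀ z z', e z * e' z' = 0) :
    crossTerm e e' = 0 := by
  exact TensorProduct.ext' fun q q' => h _ _

/-- The map on functions `A/I² ⊗ A/I² → C` given by a pair of points of the first infinitesimal
neighbourhood of the unit section. Composed with the comultiplication it gives their product. -/
def infMul (e e' : CoLie ε →ₗ[R] C) (he : ∀ z z', e z * e z' = 0)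
    (he' : ∀ z z', e' z * e' z' = 0) : InfOne ε ⊗[R] InfOne ε →ₐ[R] C :=
  Algebra.TensorProduct.lift (infExp e he) (infExp e' he') fun _ _ => Commute.all _ _

theorem infMul_comul (μ : InfComul ε) (e e' : CoLie ε →ₗ[R] C) (he : ∀ z z', e z * e z' = 0)
    (he' : ∀ z z', e' z * e' z' = 0) (z : RingHom.ker ε) :
    infMul e e' he he' (μ.toAlgHom z) = e ((RingHom.ker ε).toCotangent z) +
      e' ((RingHom.ker ε).toCotangent z) + crossTerm e e' (μ.toAlgHom z) := by
  have key : ∀ u : InfOne ε ⊗[R] InfOne ε, infMul e e' he he' u =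
      algebraMap R C (InfOne.counit ε ((Algebra.TensorProduct.lift
        ((Algebra.ofId R (InfOne ε)).comp (InfOne.counit ε)) (AlgHom.id R (InfOne ε))
          fun _ _ => Commute.all _ _) u)) +
      e (InfOne.proj ε ((Algebra.TensorProduct.lift (AlgHom.id R (InfOne ε))
          ((Algebra.ofId R (InfOne ε)).comp (InfOne.counit ε)) fun _ _ => Commute.all _ _) u)) +
      e' (InfOne.proj ε ((Algebra.TensorProduct.lift
        ((Algebra.ofId R (InfOne ε)).comp (InfOne.counit ε)) (AlgHom.id R (InfOne ε))
          fun _ _ => Commute.all _ _) u)) + crossTerm e e' u := by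
    intro u
    induction u with
    | zero => simp
    | add u v hu hv => simp only [map_add, hu, hv]; ring
    | tmul q q' =>
      have e1 : ∀ (r : R) (q : InfOne ε),
          InfOne.proj ε (q * algebraMap R _ r) = r • InfOne.proj ε q := fun r q => by
        rw [mul_comm, ← Algebra.smul_def, map_smul]
      have e2 : ∀ (r : R) (q : InfOne ε),
          InfOne.proj ε (algebraMap R _ r * q) = r • InfOne.proj ε q := fun r q => by
        rw [← Algebra.smul_def, map_smul]
      simp only [infMul, Algebra.TensorProduct.lift_tmul, infExp_apply, crossTerm_tmul,
        AlgHom.comp_apply, AlgHom.coe_id, id_eq, Algebra.ofId_apply, e1, e2, map_smul, map_mul,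
        AlgHom.commutes, Algebra.algebraMap_self, RingHom.id_apply, Algebra.smul_def]
      ring
  have hl : ∀ a, _ = _ := fun a => DFunLike.congr_fun μ.counit_left a
  have hr : ∀ a, _ = _ := fun a => DFunLike.congr_fun μ.counit_right a
  simp only [AlgHom.comp_apply] at hl hr
  rw [key, hl, hr]
  change algebraMap R C (InfOne.counit ε (Ideal.Quotient.mk _ (z : A))) +
    e (InfOne.proj ε (Ideal.Quotient.mk _ (z : A))) +
    e' (InfOne.proj ε (Ideal.Quotient.mk _ (z : A))) + _ = _
  rw [InfOne.proj_mk_of_mem, InfOne.counit_mk, show ε z = 0 from z.2, map_zero, zero_add]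

variable {B : Type u} [CommRing B] [Algebra R B]

/-- The `C`-valued point of the group given by a form `φ : I/I² → Ωⁿ` of positive degree and an
infinitesimal simplex `ξ`: it is `z ↦ φ(z)(ξ)` on `I`. It is multiplicative since two values of a form
of positive degree have product zero. -/
def evalLie {n : ℕ} (ξ : Fin (n + 2) → B →ₐ[R] C) (h : IsInfClose fun i => (ξ i).toRingHom)
    (φ : CoLie ε →ₗ[R] KForm R B (n + 1)) : A →ₐ[R] C :=
  ptExp ((evalAlg ξ h).comp φ) fun _ _ => evalAlg_mul_evalAlg ξ h _ _

theorem evalLie_apply {n : ℕ} (ξ : Fin (n + 2) → B →ₐ[R] C)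
    (h : IsInfClose fun i => (ξ i).toRingHom) (φ : CoLie ε →ₗ[R] KForm R B (n + 1))
    (z : RingHom.ker ε) :
    evalLie ξ h φ z = evalAlg ξ h (φ ((RingHom.ker ε).toCotangent z)) :=
  ptExp_apply _ _ z

/-- The factorization of `evalLie` through the ring `A/I²` of the first infinitesimal neighbourhood. -/
def evalInf {n : ℕ} (ξ : Fin (n + 2) → B →ₐ[R] C) (h : IsInfClose fun i => (ξ i).toRingHom)
    (φ : CoLie ε →ₗ[R] KForm R B (n + 1)) : InfOne ε →ₐ[R] C :=
  infExp ((evalAlg ξ h).comp φ) fun _ _ => evalAlg_mul_evalAlg ξ h _ _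

/-- The product of two points of the first infinitesimal neighbourhood of the unit section. -/
def mulInf (μ : InfComul ε) (α β : InfOne ε →ₐ[R] C) : A →ₐ[R] C :=
  (Algebra.TensorProduct.lift α β fun _ _ => Commute.all _ _).comp μ.toAlgHom

/-- The points given by a `1`-form on an edge and on the reversed edge are inverse to each other. -/
theorem mulInf_swap (μ : InfComul ε) {n : ℕ} {ξ : Fin (n + 1) → B →ₐ[R] C}
    (h : IsInfClose fun i => (ξ i).toRingHom) (i j : Fin (n + 1))
    (φ : CoLie ε →ₗ[R] KForm R B 1) :
    mulInf μ (evalInf ![ξ i, ξ j] (h.pair i j) φ) (evalInf ![ξ j, ξ i] (h.pair j i) φ) =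
      (Algebra.ofId R C).comp ε := by
  refine algHom_ext_of_ker (ε := ε) fun z => ?_
  refine (infMul_comul μ _ _ _ _ z).trans ?_
  -- Both factors of a cross term are values of forms on the same edge, up to sign.
  rw [crossTerm_eq_zero, AlgHom.comp_apply, show ε z = 0 from z.2, map_zero,
    LinearMap.zero_apply, add_zero, LinearMap.comp_apply, LinearMap.comp_apply,
    evalAlg_swap h i j, neg_add_cancel]
  intro z z'
  rw [LinearMap.comp_apply, LinearMap.comp_apply, evalAlg_swap h j i, mul_neg,
    evalAlg_mul_evalAlg, neg_zero]

theorem evalAlg_wedgeExt (ξ : Fin 3 → B →ₐ[R] C)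
    (h : IsInfClose fun i => (ξ i).toRingHom) (φ : CoLie ε →ₗ[R] KForm R B 1)
    (u : InfOne ε ⊗[R] InfOne ε) :
    evalAlg ξ h (wedgeExt φ u) = crossTerm ((evalAlg ![ξ 0, ξ 1] (h.pair 0 1)).comp φ)
      ((evalAlg ![ξ 1, ξ 2] (h.pair 1 2)).comp φ) u := by
  induction u with
  | zero => simp
  | add u v hu hv => rw [map_add, map_add, map_add, hu, hv]
  | tmul q q' => exact evalAlg_wedgeOne ξ h _ _

/-- The structural equation on one triangle, in the form `ω(x₀, x₁) ω(x₁, x₂) = θ ω(x₀, x₂)` for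
`θ = dω + [ω]^{(2)}`. -/
theorem mulInf_triangle (μ : InfComul ε) (ξ : Fin 3 → B →ₐ[R] C)
    (h : IsInfClose fun i => (ξ i).toRingHom) (φ : CoLie ε →ₗ[R] KForm R B 1) :
    mulInf μ (evalInf ![ξ 0, ξ 1] (h.pair 0 1) φ) (evalInf ![ξ 1, ξ 2] (h.pair 1 2) φ) =
      mulInf μ (evalInf ξ h ((dForm R B).comp φ + sqForm μ φ))
        (evalInf ![ξ 0, ξ 2] (h.pair 0 2) φ) := by
  refine algHom_ext_of_ker (ε := ε) fun z => ?_
  refine (infMul_comul μ _ _ _ _ z).trans ?_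
  refine Eq.trans ?_ (infMul_comul μ _ _ _ _ z).symm
  -- The cross terms of `θ` and `ω(x₀, x₂)` vanish: both have factors of the form `x₂ b - x₀ b`.
  rw [crossTerm_eq_zero ((evalAlg ξ h).comp _), LinearMap.zero_apply, add_zero]
  · simp only [LinearMap.comp_apply, LinearMap.add_apply, map_add]
    rw [evalAlg_dForm, sqForm_toCotangent, evalAlg_wedgeExt]
    ring
  · intro z z'
    rw [LinearMap.comp_apply, LinearMap.comp_apply]
    refine evalAlg_mul_eq_zero ξ h _ 1 fun b => ?_
    rw [mul_comm]
    refine evalAlg_mul_eq_zero ![ξ 0, ξ 2] _ _ 0 fun b' => ?_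
    exact h.sq 2 0 b' b

end Hopf

/-! ### Affine points and charts -/

section Geometry

open CategoryTheory AlgebraicGeometry MonoidalCategory CartesianMonoidalCategory MonObj Limits

theorem specMap_fromSpec_appLE {Y : Scheme.{u}} {U : Y.Opens} (hU : IsAffineOpen U)
    {C : CommRingCat.{u}} (g : Γ(Y, U) ⟶ C) (p : Spec C ⟶ Y) (hp : p = Spec.map g ≫ hU.fromSpec)
    (h : ⊤ ≤ p ⁻¹ᵁ U) : p.appLE U ⊤ h = g ≫ (Scheme.ΓSpecIso C).inv := by
  have h1 := IsAffineOpen.SpecMap_appLE_fromSpec p hU (isAffineOpen_top _) h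
  rw [IsAffineOpen.fromSpec_top, Scheme.isoSpec_Spec_inv] at h1
  apply Spec.map_injective
  rw [← cancel_mono hU.fromSpec, h1, Spec.map_comp, Category.assoc, hp]

/-- A morphism `Spec C ⟶ Y` that lands in an affine open is given by the map on functions. -/
theorem eq_specMap_fromSpec {Y : Scheme.{u}} {U : Y.Opens} (hU : IsAffineOpen U)
    {C : CommRingCat.{u}} (p : Spec C ⟶ Y) (h : ⊤ ≤ p ⁻¹ᵁ U) :
    p = Spec.map (p.appLE U ⊤ h ≫ (Scheme.ΓSpecIso C).hom) ≫ hU.fromSpec := by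
  have h1 := IsAffineOpen.SpecMap_appLE_fromSpec p hU (isAffineOpen_top _) h
  rw [IsAffineOpen.fromSpec_top, Scheme.isoSpec_Spec_inv] at h1
  rw [Spec.map_comp, Category.assoc, h1, ← Category.assoc, ← Spec.map_comp, Iso.inv_hom_id,
    Spec.map_id, Category.id_comp]

theorem specMap_fromSpec_le {Y : Scheme.{u}} {U : Y.Opens} (hU : IsAffineOpen U)
    {C : CommRingCat.{u}} (g : Γ(Y, U) ⟶ C) : ⊤ ≤ (Spec.map g ≫ hU.fromSpec) ⁻¹ᵁ U := by
  intro t _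
  change hU.fromSpec (Spec.map g t) ∈ (U : Set Y)
  rw [← hU.range_fromSpec]
  exact ⟨_, rfl⟩

/-- Sections of the structure sheaf that agree on a jointly surjective family of open immersions
are equal. -/
theorem section_eq_of_local {T : Scheme.{u}} {O : T.Opens} {s s' : Γ(T, O)}
    (h : ∀ t ∈ O, ∃ (Z : Scheme.{u}) (j : Z ⟶ T) (_ : IsOpenImmersion j) (hj : ⊤ ≤ j ⁻¹ᵁ O),
      t ∈ Set.range j ∧ j.appLE O ⊤ hj s = j.appLE O ⊤ hj s') : s = s' := by
  refine TopCat.Presheaf.section_ext T.sheaf O s s' fun t ht => ?_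
  obtain ⟨Z, j, _, hj, ⟨z, rfl⟩, e⟩ := h t ht
  have h1 : ∀ s : Γ(T, O), j.stalkMap z (T.presheaf.germ O (j z) ht s) =
      Z.presheaf.germ ⊤ z trivial (j.appLE O ⊤ hj s) := by
    intro s
    have := Scheme.Hom.germ_stalkMap_apply j O z ht s
    rw [this, Scheme.Hom.appLE, CommRingCat.comp_apply]
    exact (TopCat.Presheaf.germ_res_apply _ _ _ _ _).symm
  have h2 : Function.Injective (j.stalkMap z) :=
    ((ConcreteCategory.isIso_iff_bijective (j.stalkMap z)).1 inferInstance).1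
  apply h2
  exact (h1 s).trans ((congrArg _ e).trans (h1 s').symm)

variable {S : Scheme.{u}}

/-- Morphisms of `S`-schemes that agree on a jointly surjective family of open immersions are
equal. -/
theorem over_hom_eq_of_local {T Y : Over S} {f g : T ⟶ Y}
    (h : ∀ t : T.left, ∃ (Z : Over S) (j : Z ⟶ T), IsOpenImmersion j.left ∧
      t ∈ Set.range j.left ∧ j ≫ f = j ≫ g) : f = g := by
  choose Z j hj ht e using h
  ext1
  let 𝒰 : T.left.OpenCover := Scheme.Cover.mkOfCovers T.left (fun t => (Z t).left)
    (fun t => (j t).left) (fun t => ⟨t, ht t⟩) hj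
  refine Scheme.Cover.hom_ext 𝒰 _ _ fun t => ?_
  exact congrArg (fun k => k.left) (e t)

theorem over_hom_apply {T Y : Over S} (f : T ⟶ Y) (t : T.left) :
    Y.hom (f.left t) = T.hom t := by
  rw [← Scheme.Hom.comp_apply, Over.w f]

variable {X G : Over S} [GrpObj G]

/-- There are arbitrarily small charts around each point `u` of `X`. -/
theorem Chart.exists_small (u : X.left) (V₀ : S.Opens) (U₀ : X.left.Opens) (W₀ : G.left.Opens)
    (hV : X.hom u ∈ V₀) (hU : u ∈ U₀) (hW : unitSection G (X.hom u) ∈ W₀) :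
    ∃ c : Chart X G, u ∈ c.U ∧ c.V ≤ V₀ ∧ c.U ≤ U₀ ∧ c.W ≤ W₀ := by
  have hew : G.hom (unitSection G (X.hom u)) = X.hom u := by
    have := congrArg (fun f : S ⟶ S => f (X.hom u)) (unitSection_comp (G := G))
    simpa using this
  obtain ⟨V₁, hV₁, hu₁, hle₁⟩ := exists_isAffineOpen_mem_and_subset hV
  obtain ⟨W₁, hW₁, hew₁, hleW⟩ := exists_isAffineOpen_mem_and_subset
    (U := W₀ ⊓ G.hom ⁻¹ᵁ V₁) (x := unitSection G (X.hom u)) ⟨hW, by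
      change G.hom (unitSection G (X.hom u)) ∈ V₁
      rw [hew]; exact hu₁⟩
  -- The unit section need not map `V₁` into `W₁`; both are shrunk by the same function `f` on the base.
  obtain ⟨f, hf, huf⟩ := hV₁.exists_basicOpen_le (V := V₁ ⊓ unitSection G ⁻¹ᵁ W₁)
    ⟨X.hom u, ⟨hu₁, hew₁⟩⟩ hu₁
  have hWV : W₁ ≤ G.hom ⁻¹ᵁ V₁ := fun w hw => (hleW hw).2
  obtain ⟨U₁, hU₁, hu, hleU⟩ := exists_isAffineOpen_mem_and_subset
    (U := U₀ ⊓ X.hom ⁻¹ᵁ (S.basicOpen f)) (x := u) ⟨hU, huf⟩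
  refine ⟨⟨S.basicOpen f, U₁, G.left.basicOpen (G.hom.appLE V₁ W₁ hWV f), hV₁.basicOpen f, hU₁,
    hW₁.basicOpen _, fun x hx => (hleU hx).2, ?_, ?_⟩, hu, ?_, ?_, ?_⟩
  · rw [Scheme.basicOpen_appLE]
    exact inf_le_right
  · rw [Scheme.basicOpen_appLE]
    intro v hv
    refine ⟨(hf hv).2, ?_⟩
    change G.hom (unitSection G v) ∈ S.basicOpen f
    have := congrArg (fun f : S ⟶ S => f v) (unitSection_comp (G := G))
    have h2 : G.hom (unitSection G v) = v := by simpa using this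
    rw [h2]
    exact hv
  · exact (S.basicOpen_le f).trans hle₁
  · exact fun x hx => (hleU hx).1
  · exact (G.left.basicOpen_le _).trans fun w hw => (hleW hw).1

namespace Chart

variable (c : Chart X G) {C : Type u} [CommRing C] [Algebra c.R C]

/-- The point of `X` given by an algebra map on functions. -/
def ptX (ξ : c.B →ₐ[c.R] C) : c.spec C ⟶ X :=
  Over.homMk (Spec.map (CommRingCat.ofHom ξ.toRingHom) ≫ c.affU.fromSpec) <| by
    change (Spec.map (CommRingCat.ofHom ξ.toRingHom) ≫ c.affU.fromSpec) ≫ X.hom =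
      Spec.map (CommRingCat.ofHom (algebraMap c.R C)) ≫ c.affV.fromSpec
    have h : CommRingCat.ofHom (algebraMap c.R C) =
        X.hom.appLE c.V c.U c.leU ≫ CommRingCat.ofHom ξ.toRingHom := by
      ext r
      exact (ξ.commutes r).symm
    rw [Category.assoc, h, Spec.map_comp, Category.assoc,
      IsAffineOpen.SpecMap_appLE_fromSpec _ c.affV c.affU c.leU]

theorem ptX_left (ξ : c.B →ₐ[c.R] C) : (c.ptX ξ).left =
    Spec.map (CommRingCat.ofHom ξ.toRingHom) ≫ c.affU.fromSpec := rfl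

theorem pt_left (α : c.A →ₐ[c.R] C) : (c.pt α).left =
    Spec.map (CommRingCat.ofHom α.toRingHom) ≫ c.affW.fromSpec := rfl

theorem specMap_ptX {D : Type u} [CommRing D] [Algebra c.R D] (f : C →ₐ[c.R] D)
    (ξ : c.B →ₐ[c.R] C) : c.specMap f ≫ c.ptX ξ = c.ptX (f.comp ξ) := by
  ext1
  change Spec.map (CommRingCat.ofHom f.toRingHom) ≫
    Spec.map (CommRingCat.ofHom ξ.toRingHom) ≫ c.affU.fromSpec =
      Spec.map (CommRingCat.ofHom (f.comp ξ).toRingHom) ≫ c.affU.fromSpec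
  rw [← Category.assoc, ← Spec.map_comp]
  rfl

theorem ptX_le (ξ : c.B →ₐ[c.R] C) : (⊤ : (c.spec C).left.Opens) ≤ (c.ptX ξ).left ⁻¹ᵁ c.U :=
  specMap_fromSpec_le _ _

theorem pt_le (α : c.A →ₐ[c.R] C) : (⊤ : (c.spec C).left.Opens) ≤ (c.pt α).left ⁻¹ᵁ c.W :=
  specMap_fromSpec_le _ _

variable (C) in
/-- The elements of `C`, as functions on its spectrum. -/
def toΓ : C →+* Γ((c.spec C).left, ⊤) := (Scheme.ΓSpecIso (.of C)).inv.hom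

variable (C) in
theorem toΓ_injective : Function.Injective (c.toΓ C) :=
  ((ConcreteCategory.isIso_iff_bijective (Scheme.ΓSpecIso (.of C)).inv).1 inferInstance).1

theorem ptX_appLE (ξ : c.B →ₐ[c.R] C) (h) (b : c.B) :
    ((c.ptX ξ).left.appLE c.U ⊤ h).hom b = c.toΓ C (ξ b) := by
  have := specMap_fromSpec_appLE c.affU (CommRingCat.ofHom ξ.toRingHom) _ (c.ptX_left ξ) h
  exact DFunLike.congr_fun (congrArg CommRingCat.Hom.hom this) b

theorem pt_appLE (α : c.A →ₐ[c.R] C) (h) (a : c.A) :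
    ((c.pt α).left.appLE c.W ⊤ h).hom a = c.toΓ C (α a) := by
  have := specMap_fromSpec_appLE c.affW (CommRingCat.ofHom α.toRingHom) _ (c.pt_left α) h
  exact DFunLike.congr_fun (congrArg CommRingCat.Hom.hom this) a

/-- A morphism over `S` is compatible with the maps from the functions on the base. -/
theorem algebraMap_eq_of_over {Y : Over S} {O : Y.left.Opens} (hO : IsAffineOpen O)
    (hle : O ≤ Y.hom ⁻¹ᵁ c.V) (p : c.spec C ⟶ Y) (g : Γ(Y.left, O) →+* C)
    (hg : p.left = Spec.map (CommRingCat.ofHom g) ≫ hO.fromSpec) (r : c.R) :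
    g ((Y.hom.appLE c.V O hle).hom r) = algebraMap c.R C r := by
  have hc : Y.hom.appLE c.V O hle ≫ CommRingCat.ofHom g =
      CommRingCat.ofHom (algebraMap c.R C) := by
    apply Spec.map_injective
    have hw : (Spec.map (CommRingCat.ofHom g) ≫ hO.fromSpec) ≫ Y.hom =
        Spec.map (CommRingCat.ofHom (algebraMap c.R C)) ≫ c.affV.fromSpec :=
      (congrArg (fun k : Spec (.of C) ⟶ Y.left => k ≫ Y.hom) hg).symm.trans (Over.w p)
    rw [← cancel_mono c.affV.fromSpec, ← hw, Spec.map_comp, Category.assoc,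
      IsAffineOpen.SpecMap_appLE_fromSpec _ c.affV hO hle, Category.assoc]
  exact DFunLike.congr_fun (congrArg CommRingCat.Hom.hom hc) r

theorem exists_ptX (p : c.spec C ⟶ X) (h : (⊤ : (c.spec C).left.Opens) ≤ p.left ⁻¹ᵁ c.U) :
    ∃ ξ : c.B →ₐ[c.R] C, c.ptX ξ = p := by
  have h1 := eq_specMap_fromSpec (C := .of C) c.affU p.left h
  refine ⟨{ (p.left.appLE c.U ⊤ h ≫ (Scheme.ΓSpecIso (.of C)).hom).hom with
    commutes' := fun r => ?_ }, ?_⟩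
  · exact c.algebraMap_eq_of_over c.affU c.leU p _ h1 r
  · ext1
    exact h1.symm

theorem exists_pt_of_le (p : c.spec C ⟶ G) (h : (⊤ : (c.spec C).left.Opens) ≤ p.left ⁻¹ᵁ c.W) :
    ∃ α : c.A →ₐ[c.R] C, c.pt α = p := by
  have h1 := eq_specMap_fromSpec (C := .of C) c.affW p.left h
  refine ⟨{ (p.left.appLE c.W ⊤ h ≫ (Scheme.ΓSpecIso (.of C)).hom).hom with
    commutes' := fun r => ?_ }, ?_⟩
  · exact c.algebraMap_eq_of_over c.affW c.leW p _ h1 r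
  · ext1
    exact h1.symm

/-- A point of an `S`-scheme that lies over the base of a chart has arbitrarily small affine
neighbourhoods. -/
theorem exists_spec_nhd (T : Over S) (t : T.left) (O : T.left.Opens) (ht : t ∈ O)
    (hV : T.hom t ∈ c.V) :
    ∃ (C : Type u) (_ : CommRing C) (_ : Algebra c.R C) (j : c.spec C ⟶ T),
      IsOpenImmersion j.left ∧ t ∈ Set.range j.left ∧
        (⊤ : (c.spec C).left.Opens) ≤ j.left ⁻¹ᵁ O := by
  obtain ⟨T', hT', ht', hle⟩ := exists_isAffineOpen_mem_and_subset
    (U := O ⊓ T.hom ⁻¹ᵁ c.V) (x := t) ⟨ht, hV⟩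
  have hTV : T' ≤ T.hom ⁻¹ᵁ c.V := fun x hx => (hle hx).2
  let _ : Algebra c.R Γ(T.left, T') := (T.hom.appLE c.V T' hTV).hom.toAlgebra
  have hr : Set.range hT'.fromSpec = (T' : Set T.left) := hT'.range_fromSpec
  refine ⟨Γ(T.left, T'), inferInstance, inferInstance, Over.homMk hT'.fromSpec ?_, ?_, ?_, ?_⟩
  · change hT'.fromSpec ≫ T.hom = Spec.map (T.hom.appLE c.V T' hTV) ≫ c.affV.fromSpec
    rw [IsAffineOpen.SpecMap_appLE_fromSpec _ c.affV hT' hTV]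
  · exact IsAffineOpen.isOpenImmersion_fromSpec hT'
  · change t ∈ Set.range hT'.fromSpec
    rw [hr]
    exact ht'
  · intro z _
    have hz : hT'.fromSpec z ∈ (T' : Set T.left) := by rw [← hr]; exact ⟨z, rfl⟩
    exact (hle hz).1

/-- Locally, points that coincide topologically come from algebra maps on functions on a chart. -/
theorem exists_spec_nhd_ptX {T : Over S} {n : ℕ} (x : Fin (n + 1) → (T ⟶ X))
    (hx : ∀ i (t : T.left), (x i).left t = (x 0).left t) (t : T.left) (O : T.left.Opens)
    (ht : t ∈ O) (hU : (x 0).left t ∈ c.U) :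
    ∃ (C : Type u) (_ : CommRing C) (_ : Algebra c.R C) (j : c.spec C ⟶ T)
      (ξ : Fin (n + 1) → c.B →ₐ[c.R] C),
      IsOpenImmersion j.left ∧ t ∈ Set.range j.left ∧
        (⊤ : (c.spec C).left.Opens) ≤ j.left ⁻¹ᵁ O ∧ ∀ i, j ≫ x i = c.ptX (ξ i) := by
  have hV : T.hom t ∈ c.V := by
    rw [← over_hom_apply (x 0) t]
    exact c.leU hU
  obtain ⟨C, _, _, j, h1, h2, h3⟩ := c.exists_spec_nhd T t (O ⊓ (x 0).left ⁻¹ᵁ c.U) ⟨ht, hU⟩ hV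
  have h4 : ∀ i, (⊤ : (c.spec C).left.Opens) ≤ (j ≫ x i).left ⁻¹ᵁ c.U := fun i z hz => by
    change (x i).left (j.left z) ∈ c.U
    rw [hx]
    exact (h3 hz).2
  choose ξ hξ using fun i => c.exists_ptX (j ≫ x i) (h4 i)
  exact ⟨C, _, _, j, ξ, h1, h2, fun z hz => (h3 hz).1, fun i => (hξ i).symm⟩

end Chart

end Geometry

/-! ### Infinitesimal simplices with values in a chart -/

section Algebra

/-- Infinitesimal closeness passes to localizations of the ring of functions. -/
theorem IsInfClose.of_isLocalization {B B' C : Type u} [CommRing B] [CommRing B'] [CommRing C]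
    [Algebra B B'] (M : Submonoid B) [IsLocalization M B'] {n : ℕ} {y : Fin (n + 1) → B' →+* C}
    (h : IsInfClose fun i => (y i).comp (algebraMap B B')) : IsInfClose y := by
  have key : ∀ s : B', ∃ (b w : B), (∀ i, IsUnit (y i (algebraMap B B' w))) ∧
      ∀ i, y i s * y i (algebraMap B B' w) = y i (algebraMap B B' b) := by
    intro s
    obtain ⟨⟨b, w⟩, hw⟩ := IsLocalization.surj M s
    exact ⟨b, w, fun i => (IsLocalization.map_units B' w).map (y i), fun i => by
      rw [← map_mul, hw]⟩
  have hsq : ∀ i j b b', (y i (algebraMap B B' b) - y j (algebraMap B B' b)) *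
    (y i (algebraMap B B' b') - y j (algebraMap B B' b')) = 0 := h.sq
  have hst : ∀ i j b, (y i (algebraMap B B' b) - y 0 (algebraMap B B' b)) *
    (y j (algebraMap B B' b) - y 0 (algebraMap B B' b)) = 0 := h.strong
  have hst₂ : ∀ i j b b', (y i (algebraMap B B' b) - y 0 (algebraMap B B' b)) *
    (y j (algebraMap B B' b') - y 0 (algebraMap B B' b')) +
    (y i (algebraMap B B' b') - y 0 (algebraMap B B' b')) *
    (y j (algebraMap B B' b) - y 0 (algebraMap B B' b)) = 0 := h.strong₂
  constructor
  · intro i j s s'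
    obtain ⟨b, w, hu, e⟩ := key s
    obtain ⟨b', w', hu', e'⟩ := key s'
    refine (((hu i).mul (hu j)).mul ((hu' i).mul (hu' j))).mul_left_eq_zero.1 ?_
    have h1 : (y i s - y j s) * (y i (algebraMap B B' w) * y j (algebraMap B B' w)) =
        (y i (algebraMap B B' b) - y j (algebraMap B B' b)) * y j (algebraMap B B' w) -
        y j (algebraMap B B' b) * (y i (algebraMap B B' w) - y j (algebraMap B B' w)) := by
      linear_combination y j (algebraMap B B' w) * e i - y i (algebraMap B B' w) * e j
    have h2 : (y i s' - y j s') * (y i (algebraMap B B' w') * y j (algebraMap B B' w')) =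
        (y i (algebraMap B B' b') - y j (algebraMap B B' b')) * y j (algebraMap B B' w') -
        y j (algebraMap B B' b') * (y i (algebraMap B B' w') - y j (algebraMap B B' w')) := by
      linear_combination y j (algebraMap B B' w') * e' i - y i (algebraMap B B' w') * e' j
    rw [mul_mul_mul_comm, h1, h2]
    linear_combination y j (algebraMap B B' w) * y j (algebraMap B B' w') * hsq i j b b' -
      y j (algebraMap B B' w) * y j (algebraMap B B' b') * hsq i j b w' -
      y j (algebraMap B B' b) * y j (algebraMap B B' w') * hsq i j w b' +
      y j (algebraMap B B' b) * y j (algebraMap B B' b') * hsq i j w w'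
  · intro i j s
    obtain ⟨b, w, hu, e⟩ := key s
    refine (((hu i).mul (hu 0)).mul ((hu j).mul (hu 0))).mul_left_eq_zero.1 ?_
    have h1 : ∀ i, (y i s - y 0 s) * (y i (algebraMap B B' w) * y 0 (algebraMap B B' w)) =
        (y i (algebraMap B B' b) - y 0 (algebraMap B B' b)) * y 0 (algebraMap B B' w) -
        y 0 (algebraMap B B' b) * (y i (algebraMap B B' w) - y 0 (algebraMap B B' w)) := fun i => by
      linear_combination y 0 (algebraMap B B' w) * e i - y i (algebraMap B B' w) * e 0
    rw [mul_mul_mul_comm, h1, h1]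
    linear_combination y 0 (algebraMap B B' w) ^ 2 * hst i j b +
      y 0 (algebraMap B B' b) ^ 2 * hst i j w -
      y 0 (algebraMap B B' b) * y 0 (algebraMap B B' w) * hst₂ i j b w

end Algebra

section Geometry

open CategoryTheory AlgebraicGeometry MonoidalCategory CartesianMonoidalCategory MonObj Limits

theorem appLE_congr_over {S : Scheme.{u}} {T Y : Over S} {f g : T ⟶ Y} (h : f = g)
    {U : Y.left.Opens} {O : T.left.Opens} (hf : O ≤ f.left ⁻¹ᵁ U) (hg : O ≤ g.left ⁻¹ᵁ U)
    (s : Γ(Y.left, U)) : (f.left.appLE U O hf).hom s = (g.left.appLE U O hg).hom s := by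
  subst h
  rfl

theorem appLE_comp_apply {T Y Z : Scheme.{u}} (f : T ⟶ Y) (g : Y ⟶ Z) {U : Z.Opens} {O : Y.Opens}
    {O' : T.Opens} (h₁ : O ≤ g ⁻¹ᵁ U) (h₂ : O' ≤ f ⁻¹ᵁ O) (h₃ : O' ≤ (f ≫ g) ⁻¹ᵁ U)
    (s : Γ(Z, U)) :
    ((f ≫ g).appLE U O' h₃).hom s = (f.appLE O O' h₂).hom ((g.appLE U O h₁).hom s) := by
  rw [← CommRingCat.comp_apply, Scheme.Hom.appLE_comp_appLE]

theorem appLE_res_apply {T Y : Scheme.{u}} (f : T ⟶ Y) {U U' : Y.Opens} {O : T.Opens}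
    (hU : U' ≤ U) (h : O ≤ f ⁻¹ᵁ U) (h' : O ≤ f ⁻¹ᵁ U') (s : Γ(Y, U)) :
    (f.appLE U O h).hom s =
      (f.appLE U' O h').hom ((Y.presheaf.map (homOfLE hU).op).hom s) := by
  rw [← CommRingCat.comp_apply, Scheme.Hom.map_appLE]

/-- Closeness of points with values in the sections of a sheaf of rings is local. -/
theorem isInfClose_of_local {T : Scheme.{u}} {O : T.Opens} {B : Type u} [CommRing B] {n : ℕ}
    {y : Fin (n + 1) → B →+* Γ(T, O)}
    (h : ∀ t ∈ O, ∃ (Z : Scheme.{u}) (j : Z ⟶ T) (_ : IsOpenImmersion j) (hj : ⊤ ≤ j ⁻¹ᵁ O),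
      t ∈ Set.range j ∧ IsInfClose fun i => (j.appLE O ⊤ hj).hom.comp (y i)) : IsInfClose y := by
  constructor
  · intro i k b b'
    refine section_eq_of_local fun t ht => ?_
    obtain ⟨Z, j, h1, hj, h2, h3⟩ := h t ht
    refine ⟨Z, j, h1, hj, h2, ?_⟩
    have := h3.sq i k b b'
    simpa using this
  · intro i k b
    refine section_eq_of_local fun t ht => ?_
    obtain ⟨Z, j, h1, hj, h2, h3⟩ := h t ht
    refine ⟨Z, j, h1, hj, h2, ?_⟩
    have := h3.strong i k b
    simpa using this

variable {S : Scheme.{u}} {X G : Over S}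

theorem CombFun.val_congr {n : ℕ} (f : CombFun X G n) {T : Over S} {x y : Fin (n + 1) → (T ⟶ X)}
    (h : x = y) (hx : IsInfSimplex x) (hy : IsInfSimplex y) : f.val x hx = f.val y hy := by
  subst h
  rfl

variable [GrpObj G]

namespace Chart

variable (c : Chart X G) {C : Type u} [CommRing C] [Algebra c.R C]

/-- Infinitesimally close algebra maps on a chart define an infinitesimal simplex. -/
theorem isInfSimplex_ptX {n : ℕ} {ξ : Fin (n + 1) → c.B →ₐ[c.R] C}
    (h : IsInfClose fun i => (ξ i).toRingHom) : IsInfSimplex fun i => c.ptX (ξ i) := by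
  have hb : ∀ i (t : (c.spec C).left), (c.ptX (ξ i)).left t = (c.ptX (ξ 0)).left t := by
    intro i t
    change c.affU.fromSpec (Spec.map (CommRingCat.ofHom (ξ i).toRingHom) t) =
      c.affU.fromSpec (Spec.map (CommRingCat.ofHom (ξ 0).toRingHom) t)
    congr 1
    refine PrimeSpectrum.ext (Ideal.ext fun b => ?_)
    change ξ i b ∈ PrimeSpectrum.asIdeal t ↔ ξ 0 b ∈ PrimeSpectrum.asIdeal t
    have h1 : ξ i b - ξ 0 b ∈ PrimeSpectrum.asIdeal t := by
      refine (PrimeSpectrum.isPrime t).mem_of_pow_mem 2 ?_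
      have h2 : (ξ i b - ξ 0 b) * (ξ i b - ξ 0 b) = 0 := h.sq i 0 b b
      rw [pow_two, h2]
      exact zero_mem _
    constructor
    · intro h2
      simpa using sub_mem h2 h1
    · intro h2
      simpa using add_mem h1 h2
  refine ⟨hb, fun U hU O hO => ?_⟩
  -- Closeness is known on `c.U`. It passes to a basic open set of `c.U` that is also one of `U`, and
  -- from there to `U`.
  refine isInfClose_of_local fun t ht => ?_
  obtain ⟨f, g, hfg, hf⟩ := exists_basicOpen_le_affine_inter hU c.affU ((c.ptX (ξ 0)).left t)
    ⟨hO 0 ht, c.ptX_le (ξ 0) trivial⟩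
  have hUf : X.left.basicOpen f ≤ U := X.left.basicOpen_le f
  have hcf : X.left.basicOpen f ≤ c.U := hfg ▸ X.left.basicOpen_le g
  let O' : (c.spec C).left.Opens := O ⊓ (c.ptX (ξ 0)).left ⁻¹ᵁ X.left.basicOpen f
  have hj : ⊤ ≤ O'.ι ⁻¹ᵁ O := fun z _ => z.2.1
  refine ⟨O', O'.ι, inferInstance, hj, ⟨⟨t, ht, hf⟩, rfl⟩, ?_⟩
  have h1 : ∀ i, ⊤ ≤ (O'.ι ≫ (c.ptX (ξ i)).left) ⁻¹ᵁ X.left.basicOpen f := fun i z _ => by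
    change (c.ptX (ξ i)).left z.1 ∈ X.left.basicOpen f
    rw [hb i]
    exact z.2.2
  suffices H : IsInfClose fun i => ((O'.ι ≫ (c.ptX (ξ i)).left).appLE
      (X.left.basicOpen f) ⊤ (h1 i)).hom by
    have := H.precomp (X.left.presheaf.map (homOfLE hUf).op).hom
    convert this using 2 with i
    ext b
    exact (appLE_comp_apply _ _ (hO i) hj ((hj.trans fun z hz => hO i hz)) b).symm.trans
      (appLE_res_apply _ hUf _ (h1 i) b)
  let _ : Algebra Γ(X.left, c.U) Γ(X.left, X.left.basicOpen f) :=
    (X.left.presheaf.map (homOfLE hcf).op).hom.toAlgebra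
  have : IsLocalization.Away g Γ(X.left, X.left.basicOpen f) :=
    c.affU.isLocalization_of_eq_basicOpen g (homOfLE hcf) hfg
  refine IsInfClose.of_isLocalization (Submonoid.powers g) ?_
  have := h.comp ((O'.ι.appLE ⊤ ⊤ le_top).hom.comp (c.toΓ C))
  convert this using 2 with i
  ext b
  refine (appLE_res_apply (O'.ι ≫ (c.ptX (ξ i)).left) hcf
    (fun z _ => c.ptX_le (ξ i) trivial) (h1 i) b).symm.trans ?_
  refine (appLE_comp_apply _ _ (c.ptX_le (ξ i)) le_top _ b).trans ?_
  rw [c.ptX_appLE]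
  rfl

theorem isInfClose_of_isInfSimplex {n : ℕ} {ξ : Fin (n + 1) → c.B →ₐ[c.R] C}
    (h : IsInfSimplex fun i => c.ptX (ξ i)) : IsInfClose fun i => (ξ i).toRingHom := by
  have := h.close c.U c.affU ⊤ (fun i => c.ptX_le (ξ i))
  constructor
  · intro i j b b'
    apply c.toΓ_injective C
    have h1 := this.sq i j b b'
    simp only [c.ptX_appLE] at h1
    simpa using h1
  · intro i j b
    apply c.toΓ_injective C
    have h1 := this.strong i j b
    simp only [c.ptX_appLE] at h1
    simpa using h1

/-- On a simplex given by algebra maps, `evalForm` is `evalAlg`, up to the identification of `C` with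
the functions on its spectrum. -/
theorem evalForm_ptX {n : ℕ} {ξ : Fin (n + 1) → c.B →ₐ[c.R] C}
    (h : IsInfClose fun i => (ξ i).toRingHom)
    (hle) (hR) (θ : KForm c.R c.B n) :
    evalForm (R := c.R) ((c.isInfSimplex_ptX h).close c.U c.affU ⊤ hle) hR θ = c.toΓ C (evalAlg ξ h θ) :=
  evalForm_comp h _ _ _ _ (fun i b => c.ptX_appLE (ξ i) (hle i) b) θ

end Chart

/-- A combinatorial function corresponds to a classical form if and only if its values on the
simplices of each chart are the points defined by the form. -/
theorem represents_iff {n : ℕ} (f : CombFun X G (n + 1)) (φ : FormFamily X G (n + 1)) :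
    Represents f φ ↔ ∀ (c : Chart X G) (C : Type u) [CommRing C] [Algebra c.R C]
      (ξ : Fin (n + 2) → c.B →ₐ[c.R] C) (h : IsInfClose fun i => (ξ i).toRingHom),
      f.val (fun i => c.ptX (ξ i)) (c.isInfSimplex_ptX h) = c.pt (evalLie ξ h (φ c)) := by
  constructor
  · intro H c C _ _ ξ h
    obtain ⟨hW, hz⟩ := H _ (c.isInfSimplex_ptX h) c ⊤ fun i => c.ptX_le (ξ i)
    obtain ⟨α, hα⟩ := c.exists_pt_of_le _ hW
    rw [← hα]
    congr 1
    refine algHom_ext_of_ker (ε := c.counit) fun z => ?_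
    apply c.toΓ_injective C
    have h1 := (hz z).trans (c.evalForm_ptX h _ _ _)
    rw [evalLie_apply]
    refine Eq.trans ?_ h1
    refine (c.pt_appLE α (c.pt_le α) z).symm.trans ?_
    exact appLE_congr_over hα (c.pt_le α) hW z
  · intro H T x hx c T' hT
    have key : ∀ t ∈ T', ∃ (C : Type u) (_ : CommRing C) (_ : Algebra c.R C) (j : c.spec C ⟶ T)
        (ξ : Fin (n + 2) → c.B →ₐ[c.R] C) (h : IsInfClose fun i => (ξ i).toRingHom),
        IsOpenImmersion j.left ∧ t ∈ Set.range j.left ∧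
          (⊤ : (c.spec C).left.Opens) ≤ j.left ⁻¹ᵁ T' ∧ (∀ i, j ≫ x i = c.ptX (ξ i)) ∧
          j ≫ f.val x hx = c.pt (evalLie ξ h (φ c)) := by
      intro t ht
      obtain ⟨C, _, _, j, ξ, h1, h2, h3, h4⟩ := c.exists_spec_nhd_ptX x hx.base t T' ht (hT 0 ht)
      have h5 : (fun i => j ≫ x i) = fun i => c.ptX (ξ i) := funext h4
      have h6 : IsInfSimplex fun i => c.ptX (ξ i) := h5 ▸ hx.precomp j
      have h := c.isInfClose_of_isInfSimplex h6
      refine ⟨C, _, _, j, ξ, h, h1, h2, h3, h4, ?_⟩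
      rw [← f.natural, f.val_congr h5 _ h6]
      exact H c C ξ h
    have hW : T' ≤ (f.val x hx).left ⁻¹ᵁ c.W := by
      intro t ht
      obtain ⟨C, _, _, j, ξ, h, h1, ⟨z, rfl⟩, h3, h4, h5⟩ := key t ht
      change (j ≫ f.val x hx).left z ∈ c.W
      rw [h5]
      exact c.pt_le _ trivial
    refine ⟨hW, fun z => section_eq_of_local fun t ht => ?_⟩
    obtain ⟨C, _, _, j, ξ, h, h1, h2, h3, h4, h5⟩ := key t ht
    refine ⟨(c.spec C).left, j.left, h1, h3, h2, ?_⟩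
    have h6 : ⊤ ≤ (j.left ≫ (f.val x hx).left) ⁻¹ᵁ c.W := by
      intro t ht
      exact hW (h3 ht)
    refine (appLE_comp_apply j.left (f.val x hx).left hW h3 h6 _).symm.trans ?_
    refine (appLE_congr_over h5 h6 (c.pt_le _) _).trans ?_
    rw [c.pt_appLE, evalLie_apply]
    refine Eq.trans ?_ (evalForm_comp (hx.close c.U c.affU T' hT)
      (IsInfSimplex.appLE_base c T' hT)
      ((c.isInfSimplex_ptX h).close c.U c.affU ⊤ fun i => c.ptX_le (ξ i))
      (IsInfSimplex.appLE_base c ⊤ fun i => c.ptX_le (ξ i)) _ (fun i b => ?_) _)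
    · exact (c.evalForm_ptX h _ _ _).symm
    · have h7 : ⊤ ≤ (j.left ≫ (x i).left) ⁻¹ᵁ c.U := by
        intro t ht
        exact hT i (h3 ht)
      refine Eq.trans ?_ (appLE_comp_apply j.left (x i).left (hT i) h3 h7 b)
      exact (appLE_congr_over (h4 i) h7 (c.ptX_le (ξ i)) b).symm

/-- A classical form is determined by its values on the infinitesimal simplices of each chart. -/
theorem Represents.unique {n : ℕ}
    (hinj : ∀ c : Chart X G, ∃ (C : Type u) (_ : CommRing C) (_ : Algebra c.R C)
      (ξ : Fin (n + 1) → c.B →ₐ[c.R] C) (h : IsInfClose fun i => (ξ i).toRingHom),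
      Function.Injective (evalAlg ξ h))
    {f : CombFun X G n} {φ ψ : FormFamily X G n} (hφ : Represents f φ) (hψ : Represents f ψ) :
    φ = ψ := by
  funext c
  obtain ⟨C, _, _, ξ, h, hi⟩ := hinj c
  refine LinearMap.ext fun z => ?_
  obtain ⟨z, rfl⟩ := Ideal.toCotangent_surjective _ z
  apply hi
  apply c.toΓ_injective C
  obtain ⟨_, h1⟩ := hφ _ (c.isInfSimplex_ptX h) c ⊤ fun i => c.ptX_le (ξ i)
  obtain ⟨_, h2⟩ := hψ _ (c.isInfSimplex_ptX h) c ⊤ fun i => c.ptX_le (ξ i)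
  exact (c.evalForm_ptX h _ _ _).symm.trans
    (((h1 z).symm.trans (h2 z)).trans (c.evalForm_ptX h _ _ _))

/-- A family of linear maps that corresponds to a combinatorial function is compatible with
restriction: on a simplex of a smaller chart, the forms on both charts describe the same point of `G`. -/
theorem Represents.isGlobal {n : ℕ}
    (hinj : ∀ c : Chart X G, ∃ (C : Type u) (_ : CommRing C) (_ : Algebra c.R C)
      (ξ : Fin (n + 1) → c.B →ₐ[c.R] C) (h : IsInfClose fun i => (ξ i).toRingHom),
      Function.Injective (evalAlg ξ h))
    {f : CombFun X G n} {φ : FormFamily X G n} (hφ : Represents f φ) : φ.IsGlobal := by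
  intro c c' hle z
  obtain ⟨C, _, _, ξ, h, hi⟩ := hinj c'
  apply hi
  apply c'.toΓ_injective C
  have hx := c'.isInfSimplex_ptX h
  have hU : ∀ i, (⊤ : (c'.spec C).left.Opens) ≤ (c'.ptX (ξ i)).left ⁻¹ᵁ c.U :=
    fun i t ht => hle.U (c'.ptX_le (ξ i) ht)
  obtain ⟨hW', h1⟩ := hφ _ hx c' ⊤ fun i => c'.ptX_le (ξ i)
  obtain ⟨hW, h2⟩ := hφ _ hx c ⊤ hU
  have e := (appLE_res_apply _ hle.W hW hW' z).symm.trans (h2 z)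
  refine ((c'.evalForm_ptX h _ _ _).symm.trans (h1 (Chart.resI hle z)).symm).trans ?_
  refine (e.trans ?_).trans (c'.evalForm_ptX h (fun i => c'.ptX_le (ξ i))
    (IsInfSimplex.appLE_base c' ⊤ fun i => c'.ptX_le (ξ i)) _)
  symm
  exact evalForm_map _ _ _ _ _ _ _
    (fun i b => (appLE_res_apply _ hle.U (hU i) (c'.ptX_le (ξ i)) b).symm) _

end Geometry

/-! ### Gluing the points defined by a global form -/

section Geometry

open CategoryTheory AlgebraicGeometry MonoidalCategory CartesianMonoidalCategory MonObj Limits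

theorem ringHom_eq_of_fromSpec {Y : Scheme.{u}} {U : Y.Opens} (hU : IsAffineOpen U) {C : Type u}
    [CommRing C] {f g : Γ(Y, U) →+* C}
    (h : Spec.map (CommRingCat.ofHom f) ≫ hU.fromSpec =
      Spec.map (CommRingCat.ofHom g) ≫ hU.fromSpec) : f = g := by
  rw [cancel_mono] at h
  exact congrArg CommRingCat.Hom.hom (Spec.map_injective h)

/-- A point of a smaller affine open, viewed as a point of a larger one. -/
theorem specMap_fromSpec_res {Y : Scheme.{u}} {U U' : Y.Opens} (hU : IsAffineOpen U)
    (hU' : IsAffineOpen U') (hle : U' ≤ U) {C : Type u} [CommRing C] (f : Γ(Y, U') →+* C) :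
    Spec.map (CommRingCat.ofHom f) ≫ hU'.fromSpec =
      Spec.map (CommRingCat.ofHom (f.comp (Y.presheaf.map (homOfLE hle).op).hom)) ≫
        hU.fromSpec := by
  rw [← IsAffineOpen.map_fromSpec hU hU' (homOfLE hle).op, ← Category.assoc, ← Spec.map_comp]
  rfl

/-- Morphisms to an `S`-scheme may be glued along a jointly surjective family of open immersions. -/
theorem exists_glue {S : Scheme.{u}} {T Y : Over S} (Z : T.left → Over S) (j : ∀ t, Z t ⟶ T)
    (hj : ∀ t, IsOpenImmersion (j t).left) (hc : ∀ t, t ∈ Set.range (j t).left)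
    (f : ∀ t, Z t ⟶ Y)
    (hf : ∀ t t' (D : Over S) (k : D ⟶ Z t) (k' : D ⟶ Z t'), k ≫ j t = k' ≫ j t' →
      k ≫ f t = k' ≫ f t') : ∃ m : T ⟶ Y, ∀ t, j t ≫ m = f t := by
  let 𝒰 : T.left.OpenCover := Scheme.Cover.mkOfCovers T.left (fun t => (Z t).left)
    (fun t => (j t).left) (fun t => ⟨t, hc t⟩) hj
  have hf' : ∀ t t' : T.left, pullback.fst (j t).left (j t').left ≫ (f t).left =
      pullback.snd (j t).left (j t').left ≫ (f t').left := by
    intro t t'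
    let D : Over S := Over.mk (pullback.fst (j t).left (j t').left ≫ (Z t).hom)
    let k : D ⟶ Z t := Over.homMk (pullback.fst (j t).left (j t').left) rfl
    let k' : D ⟶ Z t' := Over.homMk (pullback.snd (j t).left (j t').left) <| by
      change pullback.snd (j t).left (j t').left ≫ (Z t').hom =
        pullback.fst (j t).left (j t').left ≫ (Z t).hom
      rw [← Over.w (j t'), ← Over.w (j t), ← Category.assoc, ← Category.assoc]
      exact congrArg (· ≫ T.hom) pullback.condition.symm
    have h1 := hf t t' D k k' <| by
      ext1
      exact pullback.condition
    exact congrArg (fun k => k.left) h1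
  have e : ∀ t, (j t).left ≫ 𝒰.glueMorphisms (fun t => (f t).left) hf' = (f t).left :=
    fun t => 𝒰.ι_glueMorphisms (fun t => (f t).left) hf' t
  refine ⟨Over.homMk (𝒰.glueMorphisms (fun t => (f t).left) hf') ?_, fun t => ?_⟩
  · refine Scheme.Cover.hom_ext 𝒰 _ _ fun (t : T.left) => ?_
    change (j t).left ≫ 𝒰.glueMorphisms (fun t => (f t).left) hf' ≫ Y.hom = (j t).left ≫ T.hom
    rw [← Category.assoc, e, Over.w, Over.w]
  · ext1
    exact e t

variable {S : Scheme.{u}} {X G : Over S} [GrpObj G]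

namespace Chart

/-- The points of `G` given by a global form on a chart and on a smaller one are compatible. -/
theorem comp_pt_evalLie {c c' : Chart X G} (hle : c'.LE c) {n : ℕ} {φ : FormFamily X G (n + 1)}
    (hφ : φ.IsGlobal) {C C' : Type u} [CommRing C] [CommRing C'] [Algebra c.R C] [Algebra c'.R C']
    {ξ : Fin (n + 2) → c.B →ₐ[c.R] C} {ξ' : Fin (n + 2) → c'.B →ₐ[c'.R] C'}
    (h : IsInfClose fun i => (ξ i).toRingHom) (h' : IsInfClose fun i => (ξ' i).toRingHom)
    (k : c'.spec C' ⟶ c.spec C) (hk : ∀ i, k ≫ c.ptX (ξ i) = c'.ptX (ξ' i)) :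
    k ≫ c.pt (evalLie ξ h (φ c)) = c'.pt (evalLie ξ' h' (φ c')) := by
  obtain ⟨g, hg⟩ : ∃ g : C →+* C', k.left = Spec.map (CommRingCat.ofHom g) :=
    ⟨(Spec.preimage (R := .of C) (S := .of C') k.left).hom, (Spec.map_preimage _).symm⟩
  have hX : ∀ i b, g (ξ i b) = ξ' i (resB hle b) := by
    intro i
    have h1 : Spec.map (CommRingCat.ofHom g) ≫
        Spec.map (CommRingCat.ofHom (ξ i).toRingHom) ≫ c.affU.fromSpec =
        Spec.map (CommRingCat.ofHom (ξ' i).toRingHom) ≫ c'.affU.fromSpec := by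
      rw [← hg]
      exact congrArg (fun k => k.left) (hk i)
    rw [specMap_fromSpec_res c.affU c'.affU hle.U, ← Category.assoc, ← Spec.map_comp,
      ← CommRingCat.ofHom_comp] at h1
    exact DFunLike.congr_fun (ringHom_eq_of_fromSpec c.affU h1)
  have hS : ∀ r, g (algebraMap c.R C r) = algebraMap c'.R C' (resR hle r) := by
    have h1 : Spec.map (CommRingCat.ofHom g) ≫
        Spec.map (CommRingCat.ofHom (algebraMap c.R C)) ≫ c.affV.fromSpec =
        Spec.map (CommRingCat.ofHom (algebraMap c'.R C')) ≫ c'.affV.fromSpec := by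
      rw [← hg]
      exact Over.w k
    rw [specMap_fromSpec_res c.affV c'.affV hle.V, ← Category.assoc, ← Spec.map_comp,
      ← CommRingCat.ofHom_comp] at h1
    exact DFunLike.congr_fun (ringHom_eq_of_fromSpec c.affV h1)
  have hI : ∀ z : c.I, g (evalLie ξ h (φ c) z) = evalLie ξ' h' (φ c') (resA hle z) := by
    intro z
    refine Eq.trans ?_ (evalLie_apply ξ' h' (φ c') (resI hle z)).symm
    rw [evalLie_apply, hφ c c' hle z]
    refine Eq.trans ?_ (evalForm_map (h'.precomp (resB hle)) (fun i r => ?_) h' _ _ _ _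
      (fun _ _ => rfl) _).symm
    · exact (evalForm_comp h _ (h'.precomp (resB hle)) _ g (fun i b => (hX i b).symm) _).symm
    · change ξ' i (resB hle (algebraMap c.R c.B r)) = ξ' 0 (resB hle (algebraMap c.R c.B r))
      rw [← hX, ← hX, AlgHom.commutes, AlgHom.commutes]
  have hA : ∀ a, g (evalLie ξ h (φ c) a) = evalLie ξ' h' (φ c') (resA hle a) := by
    intro a
    have h1 : a = (a - algebraMap c.R c.A (c.counit a)) + algebraMap c.R c.A (c.counit a) := by
      ring
    have h2 : a - algebraMap c.R c.A (c.counit a) ∈ c.I := by simp [RingHom.mem_ker]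
    have h3 : resA hle (algebraMap c.R c.A (c.counit a)) =
        algebraMap c'.R c'.A (resR hle (c.counit a)) := by
      have h4 : G.hom.appLE c.V c.W c.leW ≫ G.left.presheaf.map (homOfLE hle.W).op =
          S.presheaf.map (homOfLE hle.V).op ≫ G.hom.appLE c'.V c'.W c'.leW := by
        rw [Scheme.Hom.appLE_map, Scheme.Hom.map_appLE]
      exact DFunLike.congr_fun (congrArg CommRingCat.Hom.hom h4) _
    rw [h1, map_add, map_add, map_add, map_add, AlgHom.commutes, h3, AlgHom.commutes, hS]
    congr 1
    exact hI ⟨_, h2⟩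
  have hG : Spec.map (CommRingCat.ofHom g) ≫
      Spec.map (CommRingCat.ofHom (evalLie ξ h (φ c)).toRingHom) ≫ c.affW.fromSpec =
      Spec.map (CommRingCat.ofHom (evalLie ξ' h' (φ c')).toRingHom) ≫ c'.affW.fromSpec := by
    rw [specMap_fromSpec_res c.affW c'.affW hle.W, ← Category.assoc, ← Spec.map_comp,
      ← CommRingCat.ofHom_comp]
    congr 3
    exact RingHom.ext hA
  ext1
  rw [← hg] at hG
  exact hG

/-- Around each point of `X` in two charts there is a chart contained in both. -/
theorem exists_le_le (c c' : Chart X G) (u : X.left) (hu : u ∈ c.U) (hu' : u ∈ c'.U) :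
    ∃ c'' : Chart X G, u ∈ c''.U ∧ c''.LE c ∧ c''.LE c' := by
  obtain ⟨c'', h1, h2, h3, h4⟩ := Chart.exists_small (G := G) u (c.V ⊓ c'.V) (c.U ⊓ c'.U)
    (c.W ⊓ c'.W) ⟨c.leU hu, c'.leU hu'⟩ ⟨hu, hu'⟩ ⟨c.unit_le (c.leU hu), c'.unit_le (c'.leU hu')⟩
  exact ⟨c'', h1, ⟨fun _ h => (h2 h).1, fun _ h => (h3 h).1, fun _ h => (h4 h).1⟩,
    ⟨fun _ h => (h2 h).2, fun _ h => (h3 h).2, fun _ h => (h4 h).2⟩⟩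

theorem exists_mem (u : X.left) : ∃ c : Chart X G, u ∈ c.U := by
  obtain ⟨c, h, -⟩ := Chart.exists_small (G := G) u ⊤ ⊤ ⊤ trivial trivial trivial
  exact ⟨c, h⟩

/-- The points of `G` given by a global form on two charts agree wherever both are defined: locally
both are the point given by the form on a chart contained in the two. -/
theorem comp_pt_evalLie_eq {c c' : Chart X G} {n : ℕ} {φ : FormFamily X G (n + 1)}
    (hφ : φ.IsGlobal) {C C' : Type u} [CommRing C] [CommRing C'] [Algebra c.R C] [Algebra c'.R C']
    {ξ : Fin (n + 2) → c.B →ₐ[c.R] C} {ξ' : Fin (n + 2) → c'.B →ₐ[c'.R] C'}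
    (h : IsInfClose fun i => (ξ i).toRingHom) (h' : IsInfClose fun i => (ξ' i).toRingHom)
    {D : Over S} (k : D ⟶ c.spec C) (k' : D ⟶ c'.spec C')
    (hk : ∀ i, k ≫ c.ptX (ξ i) = k' ≫ c'.ptX (ξ' i)) :
    k ≫ c.pt (evalLie ξ h (φ c)) = k' ≫ c'.pt (evalLie ξ' h' (φ c')) := by
  refine over_hom_eq_of_local fun d => ?_
  have hy := (c.isInfSimplex_ptX h).precomp k
  have hu : (k ≫ c.ptX (ξ 0)).left d ∈ c.U := c.ptX_le (ξ 0) (x := k.left d) trivial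
  have hu' : (k ≫ c.ptX (ξ 0)).left d ∈ c'.U := by
    rw [hk 0]
    exact c'.ptX_le (ξ' 0) (x := k'.left d) trivial
  obtain ⟨c'', hc'', hle, hle'⟩ := c.exists_le_le c' _ hu hu'
  obtain ⟨C'', _, _, j, ξ'', h1, h2, -, h4⟩ := c''.exists_spec_nhd_ptX _ hy.base d ⊤ trivial hc''
  have h5 : (fun i => j ≫ k ≫ c.ptX (ξ i)) = fun i => c''.ptX (ξ'' i) := funext h4
  have h6 : IsInfClose fun i => (ξ'' i).toRingHom :=
    c''.isInfClose_of_isInfSimplex (h5 ▸ hy.precomp j)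
  refine ⟨c''.spec C'', j, h1, h2, ?_⟩
  rw [← Category.assoc, ← Category.assoc]
  rw [comp_pt_evalLie hle hφ h h6 (j ≫ k) fun i => by rw [Category.assoc]; exact h4 i,
    comp_pt_evalLie hle' hφ h' h6 (j ≫ k') fun i => by rw [Category.assoc, ← hk]; exact h4 i]

end Chart

/-- For a global form, the points of `G` defined on the simplices of charts glue to a unique value on
each infinitesimal simplex. -/
theorem existsUnique_value {n : ℕ} {φ : FormFamily X G (n + 1)} (hφ : φ.IsGlobal) {T : Over S}
    (x : Fin (n + 2) → (T ⟶ X)) (hx : IsInfSimplex x) :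
    ∃! m : T ⟶ G, ∀ (c : Chart X G) (C : Type u) [CommRing C] [Algebra c.R C]
      (ξ : Fin (n + 2) → c.B →ₐ[c.R] C) (h : IsInfClose fun i => (ξ i).toRingHom)
      (j : c.spec C ⟶ T), (∀ i, j ≫ x i = c.ptX (ξ i)) →
        j ≫ m = c.pt (evalLie ξ h (φ c)) := by
  have key : ∀ t : T.left, ∃ (c : Chart X G) (C : Type u) (_ : CommRing C) (_ : Algebra c.R C)
      (j : c.spec C ⟶ T) (ξ : Fin (n + 2) → c.B →ₐ[c.R] C)
      (_ : IsInfClose fun i => (ξ i).toRingHom), IsOpenImmersion j.left ∧ t ∈ Set.range j.left ∧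
        ∀ i, j ≫ x i = c.ptX (ξ i) := by
    intro t
    obtain ⟨c, hc⟩ := Chart.exists_mem (G := G) ((x 0).left t)
    obtain ⟨C, _, _, j, ξ, h1, h2, -, h4⟩ := c.exists_spec_nhd_ptX x hx.base t ⊤ trivial hc
    have h5 : (fun i => j ≫ x i) = fun i => c.ptX (ξ i) := funext h4
    exact ⟨c, C, _, _, j, ξ, c.isInfClose_of_isInfSimplex (h5 ▸ hx.precomp j), h1, h2, h4⟩
  choose c C hC hA j ξ h h1 h2 h4 using key
  obtain ⟨m, hm⟩ := exists_glue (fun t => (c t).spec (C t)) j h1 h2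
    (fun t => (c t).pt (evalLie (ξ t) (h t) (φ (c t)))) fun t t' D k k' hkk =>
      Chart.comp_pt_evalLie_eq hφ (h t) (h t') k k' fun i => by
        rw [← h4, ← h4, ← Category.assoc, ← Category.assoc, hkk]
  refine ⟨m, fun c' C' _ _ ξ' h' j' hj' => ?_, fun m' hm' => ?_⟩
  · refine over_hom_eq_of_local fun d => ?_
    obtain ⟨z, hz⟩ := h2 (j'.left d)
    have := h1 (j'.left d)
    let k := pullback.fst j'.left (j (j'.left d)).left
    let D : Over S := Over.mk (k ≫ (c'.spec C').hom)
    let a : D ⟶ c'.spec C' := Over.homMk k rfl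
    let b : D ⟶ (c (j'.left d)).spec (C (j'.left d)) :=
      Over.homMk (pullback.snd j'.left (j (j'.left d)).left) <| by
        change pullback.snd j'.left (j (j'.left d)).left ≫ Over.hom _ = k ≫ (c'.spec C').hom
        rw [← Over.w (j (j'.left d)), ← Over.w j', ← Category.assoc, ← Category.assoc]
        exact congrArg (· ≫ T.hom) pullback.condition.symm
    have hab : a ≫ j' = b ≫ j (j'.left d) := by
      ext1
      exact pullback.condition
    refine ⟨D, a, inferInstanceAs (IsOpenImmersion k), ?_, ?_⟩
    · obtain ⟨w, hw, -⟩ := Scheme.Pullback.exists_preimage_pullback (f := j'.left)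
        (g := (j (j'.left d)).left) d z hz.symm
      exact ⟨w, hw⟩
    · rw [← Category.assoc, hab, Category.assoc, hm]
      refine Chart.comp_pt_evalLie_eq hφ _ h' b a fun i => ?_
      rw [← h4, ← hj', ← Category.assoc, ← Category.assoc, hab]
  · refine over_hom_eq_of_local fun t => ⟨_, j t, h1 t, h2 t, ?_⟩
    rw [hm, hm' (c t) (C t) (ξ t) (h t) (j t) (h4 t)]

/-- Combinatorial functions that agree on the infinitesimal simplices of each chart are equal. -/
theorem CombFun.ext_of_chart {n : ℕ} {f g : CombFun X G n}
    (H : ∀ (c : Chart X G) (C : Type u) [CommRing C] [Algebra c.R C]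
      (ξ : Fin (n + 1) → c.B →ₐ[c.R] C) (h : IsInfClose fun i => (ξ i).toRingHom),
      f.val (fun i => c.ptX (ξ i)) (c.isInfSimplex_ptX h) =
        g.val (fun i => c.ptX (ξ i)) (c.isInfSimplex_ptX h)) : f = g := by
  have key : ∀ {T : Over S} (x : Fin (n + 1) → (T ⟶ X)) (hx : IsInfSimplex x),
      f.val x hx = g.val x hx := by
    intro T x hx
    refine over_hom_eq_of_local fun t => ?_
    obtain ⟨c, hc⟩ := Chart.exists_mem (G := G) ((x 0).left t)
    obtain ⟨C, _, _, j, ξ, h1, h2, -, h4⟩ := c.exists_spec_nhd_ptX x hx.base t ⊤ trivial hc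
    have h5 : (fun i => j ≫ x i) = fun i => c.ptX (ξ i) := funext h4
    have h6 : IsInfSimplex fun i => c.ptX (ξ i) := h5 ▸ hx.precomp j
    refine ⟨_, j, h1, h2, ?_⟩
    rw [← f.natural, ← g.natural, f.val_congr h5 _ h6, g.val_congr h5 _ h6]
    exact H c C ξ (c.isInfClose_of_isInfSimplex h6)
  obtain ⟨fv, fn⟩ := f
  obtain ⟨gv, gn⟩ := g
  have : @fv = @gv := by
    funext T x hx
    exact key x hx
  subst this
  rfl

end Geometry

/-! ### The correspondence in degree one and the structural equation -/

section Algebra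

variable (R B : Type u) [CommRing R] [CommRing B] [Algebra R B]

/-- Restriction of the functions on `Δ¹` to the diagonal. -/
def pairDiag : PairRing R B →ₐ[R] B :=
  Ideal.Quotient.liftₐ _ (Algebra.TensorProduct.lmul' R) fun _ ha =>
    Ideal.pow_le_self two_ne_zero ha

theorem pairDiag_comp_pairVertex (i : Fin 2) :
    (pairDiag R B).comp (pairVertex R B i) = AlgHom.id R B := by
  ext b
  fin_cases i
  · change Algebra.TensorProduct.lmul' R (b ⊗ₜ[R] (1 : B)) = b
    simp
  · change Algebra.TensorProduct.lmul' R ((1 : B) ⊗ₜ[R] b) = b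
    simp

theorem exists_evalAlg_pairVertex {q : PairRing R B} (hq : pairDiag R B q = 0) :
    ∃ η, evalAlg (pairVertex R B) (isInfClose_pairVertex R B) η = q := by
  obtain ⟨a, rfl⟩ := Ideal.Quotient.mk_surjective q
  refine ⟨(exteriorPower.oneEquiv B Ω[B⁄R]).symm
    ((KaehlerDifferential.ideal R B).toCotangent ⟨a, hq⟩), ?_⟩
  refine (evalAlg_pairVertex R B _).trans ?_
  refine (congrArg _ (LinearEquiv.apply_symm_apply _ _)).trans ?_
  exact Ideal.toCotangent_to_quotient_square _ _

/-- The diagonal of `Δ¹` has the same points as `Δ¹`, its ideal being of square zero. -/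
theorem surjective_comap_pairDiag :
    Function.Surjective (PrimeSpectrum.comap (pairDiag R B).toRingHom) := by
  have hs : Function.Surjective (pairDiag R B).toRingHom := fun b =>
    ⟨pairVertex R B 0 b, DFunLike.congr_fun (pairDiag_comp_pairVertex R B 0) b⟩
  intro p
  have hk : p ∈ PrimeSpectrum.zeroLocus (RingHom.ker (pairDiag R B).toRingHom : Set _) := by
    rw [PrimeSpectrum.mem_zeroLocus]
    intro q hq
    obtain ⟨η, rfl⟩ := exists_evalAlg_pairVertex R B (q := q) hq
    refine p.2.mem_of_pow_mem 2 ?_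
    have h0 : evalAlg (pairVertex R B) (isInfClose_pairVertex R B) η ^ 2 = 0 :=
      (pow_two _).trans (evalAlg_mul_evalAlg _ _ η η)
    exact h0 ▸ zero_mem _
  rw [← _root_.range_comap_of_surjective _ _ hs] at hk
  exact hk

/-- A point of the group with values in the functions on `Δ¹` that is trivial on the diagonal
is given by a `1`-form. -/
theorem exists_eq_evalLie {A : Type u} [CommRing A] [Algebra R A] {ε : A →ₐ[R] R}
    (α : A →ₐ[R] PairRing R B) (hα : (pairDiag R B).comp α = (Algebra.ofId R B).comp ε) :
    ∃ φ : CoLie ε →ₗ[R] KForm R B 1,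
      α = evalLie (pairVertex R B) (isInfClose_pairVertex R B) φ := by
  let E := LinearEquiv.ofInjective (evalAlg (pairVertex R B) (isInfClose_pairVertex R B))
    (evalAlg_pairVertex_injective R B)
  have h0 : ∀ z : RingHom.ker ε, pairDiag R B (α z) = 0 := fun z => by
    have := DFunLike.congr_fun hα (z : A)
    rw [AlgHom.comp_apply, AlgHom.comp_apply, show ε z = 0 from z.2, map_zero] at this
    exact this
  let f : RingHom.ker ε →ₗ[R] KForm R B 1 := E.symm.toLinearMap.comp
    (LinearMap.codRestrict _ (α.toLinearMap.comp ((RingHom.ker ε).subtype.restrictScalars R))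
      fun z => exists_evalAlg_pairVertex R B (h0 z))
  have hf : ∀ z, evalAlg (pairVertex R B) (isInfClose_pairVertex R B) (f z) = α z := fun z =>
    congrArg Subtype.val (E.apply_symm_apply _)
  refine ⟨Ideal.Cotangent.lift f fun z z' => ?_, algHom_ext_of_ker (ε := ε) fun z => ?_⟩
  · apply evalAlg_pairVertex_injective R B
    rw [hf, map_zero]
    change α ((z : A) * z') = 0
    rw [map_mul, ← hf, ← hf, evalAlg_mul_evalAlg]
  · rw [evalLie_apply, Ideal.Cotangent.lift_toCotangent, hf]

end Algebra

section Geometry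

open CategoryTheory AlgebraicGeometry MonoidalCategory CartesianMonoidalCategory MonObj Limits

variable {S : Scheme.{u}} {X G : Over S} [GrpObj G]

namespace Chart

variable (c : Chart X G)

/-- The product in `G` of two points in the first infinitesimal neighbourhood of the unit section
is computed by the comultiplication. -/
theorem pt_mul_pt {C : Type u} [CommRing C] [Algebra c.R C] (α β : InfOne c.counit →ₐ[c.R] C) :
    c.pt (α.comp (Ideal.Quotient.mkₐ c.R _)) * c.pt (β.comp (Ideal.Quotient.mkₐ c.R _)) =
      c.pt (mulInf c.comul α β) := by
  have h := congrArg (c.specMap (Algebra.TensorProduct.lift α β fun _ _ => Commute.all _ _) ≫ ·)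
    c.pt_comul
  simp only [MonObj.comp_mul, specMap_pt] at h
  have e1 : (Algebra.TensorProduct.lift α β fun _ _ => Commute.all _ _).comp c.inc₁ =
      α.comp (Ideal.Quotient.mkₐ c.R _) := by
    ext a
    simp [inc₁]
  have e2 : (Algebra.TensorProduct.lift α β fun _ _ => Commute.all _ _).comp c.inc₂ =
      β.comp (Ideal.Quotient.mkₐ c.R _) := by
    ext a
    simp [inc₂]
  rw [e1, e2] at h
  exact h.symm

theorem exists_injective_evalAlg_one : ∃ (C : Type u) (_ : CommRing C) (_ : Algebra c.R C)
    (ξ : Fin 2 → c.B →ₐ[c.R] C) (h : IsInfClose fun i => (ξ i).toRingHom),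
    Function.Injective (evalAlg ξ h) :=
  ⟨PairRing c.R c.B, inferInstance, inferInstance, pairVertex c.R c.B,
    isInfClose_pairVertex c.R c.B, evalAlg_pairVertex_injective c.R c.B⟩

theorem exists_injective_evalAlg_two : ∃ (C : Type u) (_ : CommRing C) (_ : Algebra c.R C)
    (ξ : Fin 3 → c.B →ₐ[c.R] C) (h : IsInfClose fun i => (ξ i).toRingHom),
    Function.Injective (evalAlg ξ h) :=
  ⟨TriangleRing c.R c.B, inferInstance, inferInstance, TriangleRing.vertex,
    TriangleRing.isInfClose_vertex, evalAlg_vertex_injective c.R c.B⟩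

end Chart

/-- Each combinatorial `1`-form corresponds to a classical one, which is read off from its value on
the tautological pair of points of each chart. -/
theorem CombFun.IsForm.exists_represents {ω : CombFun X G 1} (hω : ω.IsForm) :
    ∃ φ : FormFamily X G 1, Represents ω φ := by
  have key : ∀ c : Chart X G, ∃ φ : c.coLie →ₗ[c.R] KForm c.R c.B 1,
      ω.val (fun i => c.ptX (pairVertex c.R c.B i))
        (c.isInfSimplex_ptX (isInfClose_pairVertex c.R c.B)) =
      c.pt (evalLie (pairVertex c.R c.B) (isInfClose_pairVertex c.R c.B) φ) := by
    intro c
    have h1 : c.specMap (pairDiag c.R c.B) ≫ ω.val (fun i => c.ptX (pairVertex c.R c.B i))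
        (c.isInfSimplex_ptX (isInfClose_pairVertex c.R c.B)) =
        c.pt ((Algebra.ofId c.R c.B).comp c.counit) := by
      rw [← ω.natural, Chart.pt_counit]
      refine hω _ _ 0 ?_
      change c.specMap (pairDiag c.R c.B) ≫ c.ptX (pairVertex c.R c.B 0) =
        c.specMap (pairDiag c.R c.B) ≫ c.ptX (pairVertex c.R c.B 1)
      rw [Chart.specMap_ptX, Chart.specMap_ptX, pairDiag_comp_pairVertex,
        pairDiag_comp_pairVertex]
    obtain ⟨α, hα⟩ := c.exists_pt _ _ (surjective_comap_pairDiag c.R c.B) _ h1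
    rw [← hα, Chart.specMap_pt] at h1
    obtain ⟨φ, rfl⟩ := exists_eq_evalLie c.R c.B α (c.pt_injective h1)
    exact ⟨φ, hα.symm⟩
  choose φ hφ using key
  refine ⟨φ, (represents_iff ω φ).2 fun c C _ _ ξ h => ?_⟩
  have h1 : (fun i => c.ptX (ξ i)) =
      fun i => c.specMap (pairLift ξ h) ≫ c.ptX (pairVertex c.R c.B i) := by
    funext i
    rw [Chart.specMap_ptX, pairLift_pairVertex]
  have h2 := c.isInfSimplex_ptX (isInfClose_pairVertex c.R c.B)
  rw [ω.val_congr h1 _ (h2.precomp _), ω.natural _ _ h2, hφ, Chart.specMap_pt]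
  congr 1
  refine algHom_ext_of_ker (ε := c.counit) fun z => ?_
  rw [AlgHom.comp_apply, evalLie_apply, evalLie_apply, ← evalAlg_comp (pairVertex c.R c.B)
    (isInfClose_pairVertex c.R c.B) (pairLift ξ h)
    (by simpa only [pairLift_pairVertex] using h)]
  simp only [pairLift_pairVertex]

/-- Each global classical form corresponds to a combinatorial function. -/
theorem FormFamily.IsGlobal.exists_represents {n : ℕ} {φ : FormFamily X G (n + 1)}
    (hφ : φ.IsGlobal) : ∃ ω : CombFun X G (n + 1), Represents ω φ := by
  choose m hm hu using fun (T : Over S) (x : Fin (n + 2) → (T ⟶ X)) (hx : IsInfSimplex x) =>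
    existsUnique_value hφ x hx
  refine ⟨⟨fun {T} x hx => m T x hx, fun {T T'} a x hx => ?_⟩,
    (represents_iff _ φ).2 fun c C _ _ ξ h => ?_⟩
  · refine (hu T' _ (hx.precomp a) (a ≫ m T x hx) fun c C _ _ ξ h j hj => ?_).symm
    rw [← Category.assoc]
    refine hm T x hx c C ξ h (j ≫ a) fun i => ?_
    rw [Category.assoc]
    exact hj i
  · refine Eq.trans (Category.id_comp _).symm ?_
    exact hm _ _ (c.isInfSimplex_ptX h) c C ξ h (𝟙 _) fun i => Category.id_comp _

theorem Represents.combFun_unique {n : ℕ} {φ : FormFamily X G (n + 1)}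
    {ω ω' : CombFun X G (n + 1)} (h : Represents ω φ) (h' : Represents ω' φ) : ω = ω' :=
  CombFun.ext_of_chart fun c C _ _ ξ hξ =>
    ((represents_iff ω φ).1 h c C ξ hξ).trans ((represents_iff ω' φ).1 h' c C ξ hξ).symm

/-- Morphisms from the base of an infinitesimal simplex may be compared on the simplices of charts
that it induces locally. -/
theorem hom_eq_of_charts {T : Over S} {n : ℕ} {x : Fin (n + 1) → (T ⟶ X)} (hx : IsInfSimplex x)
    {p q : T ⟶ G}
    (H : ∀ (c : Chart X G) (C : Type u) [CommRing C] [Algebra c.R C]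
      (ξ : Fin (n + 1) → c.B →ₐ[c.R] C) (_ : IsInfClose fun i => (ξ i).toRingHom)
      (j : c.spec C ⟶ T), (∀ i, j ≫ x i = c.ptX (ξ i)) → j ≫ p = j ≫ q) : p = q := by
  refine over_hom_eq_of_local fun t => ?_
  obtain ⟨c, hc⟩ := Chart.exists_mem (G := G) ((x 0).left t)
  obtain ⟨C, _, _, j, ξ, h1, h2, -, h4⟩ := c.exists_spec_nhd_ptX x hx.base t ⊤ trivial hc
  have h5 : (fun i => j ≫ x i) = fun i => c.ptX (ξ i) := funext h4
  exact ⟨_, j, h1, h2, H c C ξ (c.isInfClose_of_isInfSimplex (h5 ▸ hx.precomp j)) j h4⟩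

/-- The value on an edge of a simplex, on a chart. -/
theorem Represents.comp_val_pair {ω : CombFun X G 1} {φ : FormFamily X G 1} (hr : Represents ω φ)
    {T : Over S} {n : ℕ} {x : Fin (n + 1) → (T ⟶ X)} (hx : IsInfSimplex x)
    {c : Chart X G} {C : Type u} [CommRing C] [Algebra c.R C]
    {ξ : Fin (n + 1) → c.B →ₐ[c.R] C} (h : IsInfClose fun i => (ξ i).toRingHom)
    {j : c.spec C ⟶ T} (hj : ∀ i, j ≫ x i = c.ptX (ξ i)) (i k : Fin (n + 1)) :
    j ≫ ω.val (x ∘ ![i, k]) (hx.reindex _) =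
      c.pt (evalLie ![ξ i, ξ k] (h.pair i k) (φ c)) := by
  rw [← ω.natural, ← (represents_iff ω φ).1 hr c C _ (h.pair i k)]
  refine ω.val_congr (funext fun l => ?_) _ _
  fin_cases l
  · exact hj i
  · exact hj k

theorem Represents.isForm {ω : CombFun X G 1} {φ : FormFamily X G 1} (hr : Represents ω φ) :
    ω.IsForm := by
  intro T x hx i hi
  refine hom_eq_of_charts hx fun c C _ _ ξ h j hj => ?_
  have h1 := hr.comp_val_pair hx h hj 0 1
  have h2 : x ∘ ![0, 1] = x := by
    funext l
    fin_cases l <;> rfl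
  rw [ω.val_congr h2 _ hx] at h1
  rw [h1, MonObj.comp_one, ← Chart.pt_counit]
  congr 1
  refine ptExp_eq_ofId _ _ ?_
  rw [evalAlg_eq_zero_of_eq, LinearMap.zero_comp]
  have h3 : x 0 = x 1 := by
    obtain rfl : i = 0 := Subsingleton.elim _ _
    exact hi
  have h4 : c.ptX (ξ 0) = c.ptX (ξ 1) := by rw [← hj, ← hj, h3]
  have h5 := congrArg (fun k => k.left) h4
  exact AlgHom.coe_ringHom_injective (ringHom_eq_of_fromSpec c.affU h5)

/-- A combinatorial `1`-form satisfies `ω(x, y) ω(y, x) = 1`. -/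
theorem Represents.val_mul_val_swap {ω : CombFun X G 1} {φ : FormFamily X G 1}
    (hr : Represents ω φ) {T : Over S} {n : ℕ} {x : Fin (n + 1) → (T ⟶ X)} (hx : IsInfSimplex x)
    (i k : Fin (n + 1)) :
    ω.val (x ∘ ![i, k]) (hx.reindex _) * ω.val (x ∘ ![k, i]) (hx.reindex _) = 1 := by
  refine hom_eq_of_charts hx fun c C _ _ ξ h j hj => ?_
  rw [MonObj.comp_mul, hr.comp_val_pair hx h hj, hr.comp_val_pair hx h hj, MonObj.comp_one,
    ← Chart.pt_counit, ← mulInf_swap c.comul h i k (φ c)]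
  exact c.pt_mul_pt (evalInf _ _ (φ c)) (evalInf _ _ (φ c))

/-- Cartan's structural equation `δ¹ω = dω + [ω]^{(2)}`. -/
theorem Represents.deltaOne {ω : CombFun X G 1} {φ : FormFamily X G 1}
    (hr : Represents ω φ) : Represents (deltaOne ω) (φ.d + φ.sq) := by
  refine (represents_iff _ _).2 fun c C _ _ ξ h => ?_
  have hx := c.isInfSimplex_ptX h
  have key : ∀ i k, ω.val ((fun i => c.ptX (ξ i)) ∘ ![i, k]) (hx.reindex _) =
      c.pt (evalLie ![ξ i, ξ k] (h.pair i k) (φ c)) := fun i k => by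
    rw [← hr.comp_val_pair hx h (j := 𝟙 _) (fun _ => Category.id_comp _) i k, Category.id_comp]
  change ω.val ((fun i => c.ptX (ξ i)) ∘ ![0, 1]) (hx.reindex _) *
    ω.val ((fun i => c.ptX (ξ i)) ∘ ![1, 2]) (hx.reindex _) *
    ω.val ((fun i => c.ptX (ξ i)) ∘ ![2, 0]) (hx.reindex _) = _
  -- The product of the first two factors need not lie in the first infinitesimal neighbourhood of the
  -- unit section, but it is a product `θ ω(x₀, x₂)` of two points that do.
  have h1 : ω.val ((fun i => c.ptX (ξ i)) ∘ ![0, 1]) (hx.reindex _) *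
      ω.val ((fun i => c.ptX (ξ i)) ∘ ![1, 2]) (hx.reindex _) =
      c.pt (evalLie ξ h ((φ.d + φ.sq) c)) *
        ω.val ((fun i => c.ptX (ξ i)) ∘ ![0, 2]) (hx.reindex _) := by
    rw [key, key, key]
    refine (c.pt_mul_pt (evalInf _ _ (φ c)) (evalInf _ _ (φ c))).trans ?_
    refine Eq.trans ?_ (c.pt_mul_pt (evalInf ξ h ((φ.d + φ.sq) c)) (evalInf _ _ (φ c))).symm
    exact congrArg c.pt (mulInf_triangle c.comul ξ h (φ c))
  rw [h1, _root_.mul_assoc, hr.val_mul_val_swap hx, _root_.mul_one]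

theorem Represents.deltaOne_isForm {ω : CombFun X G 1} {φ : FormFamily X G 1}
    (hr : Represents ω φ) : (CombForms.deltaOne ω).IsForm := by
  intro T x hx i hi
  change ω.val (x ∘ ![0, 1]) (hx.reindex _) * ω.val (x ∘ ![1, 2]) (hx.reindex _) *
    ω.val (x ∘ ![2, 0]) (hx.reindex _) = 1
  fin_cases i
  · have h0 : x 0 = x 1 := hi
    have e : x ∘ ![1, 2] = x ∘ ![0, 2] := by
      funext l
      fin_cases l
      · exact h0.symm
      · rfl
    rw [hr.isForm (x ∘ ![0, 1]) (hx.reindex _) 0 h0, _root_.one_mul,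
      ω.val_congr e _ (hx.reindex _), hr.val_mul_val_swap hx]
  · have h1 : x 1 = x 2 := hi
    have e : x ∘ ![2, 0] = x ∘ ![1, 0] := by
      funext l
      fin_cases l
      · exact h1.symm
      · rfl
    rw [hr.isForm (x ∘ ![1, 2]) (hx.reindex _) 0 h1, _root_.mul_one,
      ω.val_congr e _ (hx.reindex _), hr.val_mul_val_swap hx]

theorem deltaZero_isForm (g : X ⟶ G) : (deltaZero g).IsForm := by
  intro T x hx i hi
  obtain rfl : i = 0 := Subsingleton.elim _ _
  have h : x 0 = x 1 := hi
  change (x 0 ≫ g)⁻¹ * (x 1 ≫ g) = 1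
  rw [h, inv_mul_cancel]

theorem deltaOne_deltaZero (g : X ⟶ G) : deltaOne (deltaZero g) = 1 := by
  refine CombFun.ext_of_chart fun c C _ _ ξ h => ?_
  change (c.ptX (ξ 0) ≫ g)⁻¹ * (c.ptX (ξ 1) ≫ g) * ((c.ptX (ξ 1) ≫ g)⁻¹ * (c.ptX (ξ 2) ≫ g)) *
    ((c.ptX (ξ 2) ≫ g)⁻¹ * (c.ptX (ξ 0) ≫ g)) = 1
  group

theorem represents_one_zero {n : ℕ} : Represents (1 : CombFun X G (n + 1)) 0 := by
  refine (represents_iff _ _).2 fun c C _ _ ξ h => ?_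
  change 1 = _
  rw [← Chart.pt_counit]
  congr 1
  exact (ptExp_eq_ofId _ _ (LinearMap.comp_zero _)).symm

end Geometry

end CombForms

end

theorem theorem3p3 {S : Scheme.{u}} (G : Over S) [GrpObj G] [Smooth G.hom] :
    (∀ X : Over S,
      (∀ (c : Chart X G) (n : ℕ), Function.Bijective
        (dualTensorHom c.R c.coLie (KForm c.R c.B n))) ∧
      (∀ ω : CombFun X G 1, ω.IsForm → ∃! φ : FormFamily X G 1, φ.IsGlobal ∧ Represents ω φ) ∧
      (∀ φ : FormFamily X G 1, φ.IsGlobal → ∃! ω : CombFun X G 1, ω.IsForm ∧ Represents ω φ) ∧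
      (∀ (ω : CombFun X G 1) (φ : FormFamily X G 1), ω.IsForm → φ.IsGlobal → Represents ω φ →
        (deltaOne ω).IsForm ∧ (φ.d + φ.sq).IsGlobal ∧ Represents (deltaOne ω) (φ.d + φ.sq) ∧
          ∀ ψ : FormFamily X G 2, Represents (deltaOne ω) ψ → ψ = φ.d + φ.sq) ∧
      ∀ g : X ⟶ G, (deltaZero g).IsForm ∧ deltaOne (deltaZero g) = 1) ∧
    ∀ φ : FormFamily G G 1, Represents (deltaZero (𝟙 G)) φ → φ.d + φ.sq = 0 := by
  refine ⟨fun X => ⟨fun c n => ?_, fun ω hω => ?_, fun φ hφ => ?_, fun ω φ _ _ hr => ?_,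
    fun g => ⟨deltaZero_isForm g, deltaOne_deltaZero g⟩⟩, fun φ hr => ?_⟩
  · have : Algebra.Smooth c.R c.A := Scheme.Hom.smooth_appLE G.hom c.affV c.affW c.leW
    exact dualTensorHom_coLie_bijective c.counit _
  · obtain ⟨φ, hφ⟩ := hω.exists_represents
    exact ⟨φ, ⟨hφ.isGlobal Chart.exists_injective_evalAlg_one, hφ⟩, fun ψ ⟨_, hψ⟩ =>
      Represents.unique Chart.exists_injective_evalAlg_one hψ hφ⟩
  · obtain ⟨ω, hω⟩ := hφ.exists_represents
    exact ⟨ω, ⟨hω.isForm, hω⟩, fun ω' ⟨_, hω'⟩ => Represents.combFun_unique hω' hω⟩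
  · have h1 : Represents (deltaOne ω) (φ.d + φ.sq) := hr.deltaOne
    exact ⟨hr.deltaOne_isForm, h1.isGlobal Chart.exists_injective_evalAlg_two, h1,
      fun ψ hψ => Represents.unique Chart.exists_injective_evalAlg_two hψ h1⟩
  · have h1 : Represents (deltaOne (deltaZero (𝟙 G))) (φ.d + φ.sq) := hr.deltaOne
    rw [deltaOne_deltaZero] at h1
    exact Represents.unique Chart.exists_injective_evalAlg_two h1 represents_one_zero
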